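/- Let $(T(t))_{t\ge 0}$ be a $C_0$-semigroup with generator $A$ on a complex Banach space $X$, let $\alpha\ge 0$ be real and let $n\in\{0,1,2,\ldots\}$. Suppose that every $\lambda\in\mathbb{C}$ with $\operatorname{Re}\lambda\ge 0$ belongs to the resolvent set $\rho(A)$, and that there exist constants $\beta,C'\ge 0$ such that the resolvent $R(\lambda,A)=(\lambda-A)^{-1}$ satisfies $$\|R(\lambda,A)\|_{\mathcal{L}(X)}\le C'(1+|\lambda|)^{\beta}\qquad\text{for all }\lambda\in\mathbb{C}\text{ with }\operatorname{Re}\lambda\ge 0.$$ Let $(-A)^{\alpha}$ be the fractional power of $-A$, that is, the inverse of the injective bounded operator $(-A)^{-\alpha}$, where for $\alpha=m+\theta$ with $m\in\{0,1,2,\ldots\}$ and $\theta\in[0,1)$ one sets $(-A)^{-\alpha}=R(0,A)^m(-A)^{-\theta}$, with $(-A)^{-\theta}=\frac{\sin\pi\theta}{\pi}\int_0^\infty s^{-\theta}R(s,A)\,ds$ if $\theta\in(0,1)$ and $(-A)^{0}=I$. Its domain $D((-A)^{\alpha})$ carries the norm $\|x\|_{D((-A)^\alpha)}=\|x\|_X+\|(-A)^\alpha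 x\|_X$. Then the following statements are equivalent: (i) For each $k\in\{1,\ldots,n+1\}$ there exist $p,q\in[1,\infty]$ such that $m_k(\xi)=R(i\xi,A)^k$, $\xi\in\mathbb{R}$, is a bounded $(L^p(\mathbb{R};D((-A)^\alpha)),L^q(\mathbb{R};X))$ Fourier multiplier. This means that there is a $C\ge 0$ such that $\|\mathcal{F}^{-1}(m_k\cdot\mathcal{F}f)\|_{L^q(\mathbb{R};X)}\le C\|f\|_{L^p(\mathbb{R};D((-A)^\alpha))}$ for all Schwartz functions $f:\mathbb{R}\to D((-A)^\alpha)$, where $\mathcal{F}f(\xi)=\int_{\mathbb{R}}e^{-ix\xi}f(x)\,dx$. (ii) There exists a $C\ge 0$ such that $\|T(t)x\|_X\le C\,t^{-n}\,\|x\|_{D((-A)^\alpha)}$ for all $x\in D((-A)^\alpha)$ and all $t\ge 1$. -/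

import Mathlib

open MeasureTheory Filter Topology Set
open scoped NNReal ENNReal SchwartzMap

namespace PolyDecay

noncomputable section

/-- A strongly continuous one-parameter semigroup of bounded operators on `X`. -/
structure C0Semigroup (X : Type*) [NormedAddCommGroup X] [NormedSpace ℂ X] where
  /-- The operator `T(t)`, for `t ≥ 0`. -/
  op : ℝ≥0 → X →L[ℂ] X
  op_zero : op 0 = ContinuousLinearMap.id ℂ X
  op_add : ∀ s t : ℝ≥0, op (s + t) = (op s).comp (op t)
  continuous_orbit : ∀ x : X, Continuous fun t : ℝ≥0 => op t x

section Operators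

variable {X : Type*} [NormedAddCommGroup X] [NormedSpace ℂ X]

/-- The graph of the generator: the pairs `(x, y)` with `(T(t)x - x)/t → y` as `t ↓ 0`. -/
def C0Semigroup.generatorGraph (T : C0Semigroup X) : Submodule ℂ (X × X) where
  carrier := {z | Tendsto (fun t : ℝ≥0 => ((t : ℝ) : ℂ)⁻¹ • (T.op t z.1 - z.1))
    (𝓝[>] 0) (𝓝 z.2)}
  zero_mem' := by simp
  add_mem' := by
    intro a b ha hb
    refine (Tendsto.add ha hb).congr fun t => ?_
    simp only [Prod.fst_add, map_add, ← smul_add]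
    congr 1
    abel
  smul_mem' := by
    intro c a ha
    refine (Tendsto.const_smul ha c).congr fun t => ?_
    simp only [Prod.smul_fst, map_smul, ← smul_sub]
    rw [smul_comm]

/-- The generator `A` of the semigroup, an unbounded operator. Its domain is the set of those `x`
for which `lim_{t ↓ 0} (T(t)x - x)/t` exists, and `A x` is this limit. -/
def C0Semigroup.generator (T : C0Semigroup X) : X →ₗ.[ℂ] X :=
  T.generatorGraph.toLinearPMap

theorem C0Semigroup.mem_generator_graph_iff (T : C0Semigroup X) (x y : X) :
    (x, y) ∈ T.generator.graph ↔
      Tendsto (fun t : ℝ≥0 => ((t : ℝ) : ℂ)⁻¹ • (T.op t x - x)) (𝓝[>] 0) (𝓝 y) := by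
  have h : T.generator.graph = T.generatorGraph := by
    refine Submodule.toLinearPMap_graph_eq _ ?_
    rintro ⟨u, v⟩ huv (rfl : u = 0)
    have huv' : Tendsto (fun t : ℝ≥0 => ((t : ℝ) : ℂ)⁻¹ • (T.op t (0 : X) - 0))
      (𝓝[>] 0) (𝓝 v) := huv
    refine (tendsto_nhds_unique (tendsto_const_nhds (x := (0 : X))) (huv'.congr ?_)).symm
    intro t
    simp
  rw [h]
  rfl

/-- `R` is a bounded two-sided inverse of `μ - A : D(A) → X`. -/
def IsResolventAt (A : X →ₗ.[ℂ] X) (μ : ℂ) (R : X →L[ℂ] X) : Prop :=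
  (∀ x : X, ∃ h : R x ∈ A.domain, μ • R x - A ⟨R x, h⟩ = x) ∧
    ∀ y : A.domain, R (μ • (y : X) - A y) = y

/-- The resolvent set `ρ(A)`. -/
def resolventSet (A : X →ₗ.[ℂ] X) : Set ℂ :=
  {μ | ∃ R : X →L[ℂ] X, IsResolventAt A μ R}

theorem IsResolventAt.eq {A : X →ₗ.[ℂ] X} {μ : ℂ} {R S : X →L[ℂ] X}
    (hR : IsResolventAt A μ R) (hS : IsResolventAt A μ S) : R = S := by
  ext x
  obtain ⟨h, hx⟩ := hS.1 x
  have := hR.2 ⟨S x, h⟩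
  rwa [hx] at this

open Classical in
/-- The resolvent operator `R(μ, A) = (μ - A)⁻¹` for `μ ∈ ρ(A)` (and `0` for `μ ∉ ρ(A)`). -/
def resolvent (A : X →ₗ.[ℂ] X) (μ : ℂ) : X →L[ℂ] X :=
  if h : μ ∈ resolventSet A then h.choose else 0

theorem resolvent_spec {A : X →ₗ.[ℂ] X} {μ : ℂ} (h : μ ∈ resolventSet A) :
    IsResolventAt A μ (resolvent A μ) := by
  rw [resolvent, dif_pos h]
  exact h.choose_spec

/-- The bounded operator `(-A)^{-α}`, `α ≥ 0`, for an operator `A` with `[0, ∞) ⊆ ρ(A)` and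
`‖(s - A)⁻¹‖ ≤ M / (1 + s)` for `s ≥ 0` (such as a generator of a `C₀`-semigroup with
`[0, ∞) ⊆ ρ(A)`). It equals `(-A)^{-m}` for `α = m` an integer,
`(sin (π θ) / π) ∫₀^∞ s^{-θ} (s + (-A))⁻¹ ds` for `α = θ ∈ (0, 1)` (Balakrishnan's formula; the
integral converges absolutely in operator norm) and `(-A)^{-m} (-A)^{-θ}` for `α = m + θ`. -/
def invFracPow (A : X →ₗ.[ℂ] X) (α : ℝ) : X →L[ℂ] X :=
  (resolvent A 0) ^ ⌊α⌋₊ *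
    (if Int.fract α = 0 then 1
      else (Real.sin (Real.pi * Int.fract α) / Real.pi) •
        ∫ s in Ioi (0 : ℝ), s ^ (-Int.fract α) • resolvent A (s : ℂ))

/-- The fractional power `(-A)^α`, `α ≥ 0`: the inverse of the injective bounded operator
`(-A)^{-α}`, with domain the range of `(-A)^{-α}`. -/
def fracPow (A : X →ₗ.[ℂ] X) (α : ℝ) : X →ₗ.[ℂ] X :=
  (LinearMap.toPMap (invFracPow A α : X →ₗ[ℂ] X) ⊤).inverse

/-- The domain `D(B)` of an unbounded operator `B` as a space of its own, to carry the norm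
`‖x‖ + ‖B x‖`. -/
def Dom (B : X →ₗ.[ℂ] X) : Type _ := B.domain

namespace Dom

variable (B : X →ₗ.[ℂ] X)

instance : AddCommGroup (Dom B) := inferInstanceAs (AddCommGroup B.domain)

instance : Module ℂ (Dom B) := inferInstanceAs (Module ℂ B.domain)

/-- The inclusion `D(B) → X`, as a linear map. -/
def inclₗ : Dom B →ₗ[ℂ] X := B.domain.subtype

/-- The operator `B` as a linear map on its domain. -/
def applyₗ : Dom B →ₗ[ℂ] X := B.toFun

instance : Norm (Dom B) := ⟨fun x => ‖inclₗ B x‖ + ‖applyₗ B x‖⟩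

theorem norm_def (x : Dom B) : ‖x‖ = ‖inclₗ B x‖ + ‖applyₗ B x‖ := rfl

theorem core : NormedSpace.Core ℂ (Dom B) where
  norm_nonneg x := by rw [norm_def]; positivity
  norm_smul c x := by simp only [norm_def, map_smul, norm_smul]; ring
  norm_triangle x y := by
    simp only [norm_def, map_add]
    have h₁ := norm_add_le (inclₗ B x) (inclₗ B y)
    have h₂ := norm_add_le (applyₗ B x) (applyₗ B y)
    linarith
  norm_eq_zero_iff x := by
    constructor
    · intro h
      rw [norm_def] at h
      have h₁ : ‖inclₗ B x‖ = 0 := by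
        have := norm_nonneg (inclₗ B x)
        have := norm_nonneg (applyₗ B x)
        linarith
      exact Subtype.ext (norm_eq_zero.mp h₁)
    · rintro rfl
      simp [norm_def]

instance : NormedAddCommGroup (Dom B) := NormedAddCommGroup.ofCore (core B)

instance : NormedSpace ℂ (Dom B) := NormedSpace.ofCore (core B)

/-- The continuous inclusion `D(B) → X`. -/
def incl : Dom B →L[ℂ] X :=
  (inclₗ B).mkContinuous 1 fun x => by
    rw [one_mul, norm_def]
    exact le_add_of_nonneg_right (norm_nonneg _)

end Dom

end Operators

section Multipliers

variable {X Y : Type*} [NormedAddCommGroup X] [NormedSpace ℂ X]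
  [NormedAddCommGroup Y] [NormedSpace ℂ Y]

/-- The Fourier transform `ξ ↦ ∫ e^{-i x ξ} f(x) dx`. -/
def fourier (f : ℝ → X) (ξ : ℝ) : X :=
  ∫ x : ℝ, Complex.exp (-(Complex.I * x * ξ)) • f x

/-- The inverse Fourier transform `t ↦ (2π)⁻¹ ∫ e^{i t ξ} g(ξ) dξ`. -/
def fourierInv (g : ℝ → X) (t : ℝ) : X :=
  (2 * Real.pi)⁻¹ • ∫ ξ : ℝ, Complex.exp (Complex.I * t * ξ) • g ξ

/-- The Fourier multiplier operator `T_m f = 𝓕⁻¹ (m · 𝓕 f)` with operator-valued symbol `m`. -/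
def multiplierOp (m : ℝ → Y →L[ℂ] X) (f : 𝓢(ℝ, Y)) : ℝ → X :=
  fourierInv fun ξ => m ξ (fourier f ξ)

/-- `m` is a bounded `(L^p(ℝ; Y), L^q(ℝ; X))` Fourier multiplier: there is a `C ≥ 0` such that
`‖T_m f‖_{L^q(ℝ; X)} ≤ C ‖f‖_{L^p(ℝ; Y)}` for all Schwartz functions `f`. For a (measurable) symbol
of temperate growth `m · 𝓕 f` is always integrable; this is asked for, so that `T_m f` never takes
a junk value. -/
def IsBoundedMultiplier (p q : ℝ≥0∞) (m : ℝ → Y →L[ℂ] X) : Prop :=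
  ∃ C : ℝ≥0, ∀ f : 𝓢(ℝ, Y),
    Integrable (fun ξ => m ξ (fourier f ξ)) volume ∧
      eLpNorm (multiplierOp m f) q volume ≤ C * eLpNorm f p volume

end Multipliers

end

end PolyDecay

namespace PolyDecay

/-! ### Orbits of a C₀-semigroup: exponential bound, joint continuity, right derivatives. -/

section Semigroup

variable {X : Type*} [NormedAddCommGroup X] [NormedSpace ℂ X]

/-! Put S = (-A)^{-α}. Since S is bounded and injective, it is an isomorphism from X onto D((-A)^α)
with the graph norm (`exists_dom_equiv`), so both statements become statements on X: (i) about the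
symbols R(iξ)^k S, (ii) about the decay of ‖T(t)S‖. The link is that R(λ)^{k+1} is the Laplace
transform of s^k/k! · T(s), so the multiplier with symbol R(iξ)^{k+1} S should be convolution with
s^k/k! · T(s)S on the half line.

(ii) ⇒ (i): decay of rate t^{-n} makes the kernels s^k/k! · T(s)S with k ≤ n bounded, and
convolution with a bounded kernel maps L¹ to L^∞. The convolution formula holds on the lines Re λ =
ε > 0 (`C0Semigroup.fourierInv_resolvent_pow`) and passes to ε = 0 by dominated convergence, the
polynomial growth of the resolvent being absorbed by the rapid decay of 𝓕f
(`C0Semigroup.isBoundedMultiplier_of_decay`).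

(i) ⇒ (ii): only k = n + 1 is needed. No decay of the semigroup is known in advance, but for smooth
f supported in [0, 1] the transform of f is entire and decays rapidly in closed right half planes,
so the integral can be moved from the imaginary axis to a line beyond the exponential growth bound;
this gives the convolution formula again (`C0Semigroup.fourierInv_resolvent_pow_imaginary`). Test it
on f(x) = φ(x) T(x)z with a bump φ: since T(s) S T(t-s) z = T(t)Sz, the output at t is a scalar of
size at least (t-1)^n/n! · ∫φ times T(t)Sz (`C0Semigroup.norm_integral_orbit_ge`). Input and output
are estimated on intervals of length one, where the exponents p and q play no role
(`C0Semigroup.decay_of_isBoundedMultiplier`).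

That S is injective and commutes with the semigroup is proved from Balakrishnan's formula: the
integrals with exponents θ and 1 - θ multiply to a positive multiple of R(0, A), by the resolvent
identity and Frullani's integral (`exists_balakrishnan_mul`). -/

theorem C0Semigroup.op_add_apply (T : C0Semigroup X) (s t : ℝ≥0) (x : X) :
    T.op (s + t) x = T.op s (T.op t x) := by
  rw [T.op_add]; rfl

theorem C0Semigroup.op_comm (T : C0Semigroup X) (s t : ℝ≥0) (x : X) :
    T.op s (T.op t x) = T.op t (T.op s x) := by
  rw [← T.op_add_apply, add_comm, T.op_add_apply]

/-- A `C₀`-semigroup is exponentially bounded. -/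
theorem C0Semigroup.exists_exp_bound [CompleteSpace X] (T : C0Semigroup X) :
    ∃ M ω : ℝ, 1 ≤ M ∧ 0 ≤ ω ∧ ∀ t : ℝ≥0, ‖T.op t‖ ≤ M * Real.exp (ω * t) := by
  obtain ⟨M₀, hM₀⟩ : ∃ C, ∀ i : Icc (0 : ℝ≥0) 1, ‖T.op i‖ ≤ C := by
    refine banach_steinhaus (g := fun i : Icc (0 : ℝ≥0) 1 => T.op i) fun x => ?_
    obtain ⟨C, hC⟩ := (isCompact_Icc (a := (0 : ℝ≥0)) (b := 1)).exists_bound_of_continuousOn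
      (T.continuous_orbit x).continuousOn
    exact ⟨C, fun i => hC i i.2⟩
  set M := max M₀ 1 with hM
  have hM1 : 1 ≤ M := le_max_right _ _
  have hMpos : 0 < M := by linarith
  have hlog : 0 ≤ Real.log M := Real.log_nonneg hM1
  -- Each induction step splits off one factor T(1). With k = ⌊t⌋ this gives M · M^⌊t⌋ ≤ M · e^{t
  -- log M}, hence ω = log M.
  have key : ∀ k : ℕ, ∀ t : ℝ≥0, t ≤ k + 1 → ‖T.op t‖ ≤ M ^ (k + 1) := by
    intro k
    induction k with
    | zero =>
      intro t ht
      have h1 : t ≤ 1 := by simpa using ht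
      rw [zero_add, pow_one]
      exact (hM₀ ⟨t, zero_le, h1⟩).trans (le_max_left _ _)
    | succ k ih =>
      intro t ht
      rcases le_total t 1 with h1 | h1
      · exact ((hM₀ ⟨t, by simpa using h1⟩).trans (le_max_left _ _)).trans
          (le_self_pow₀ hM1 (by simp))
      · have : T.op t = (T.op 1).comp (T.op (t - 1)) := by
          rw [← T.op_add, add_tsub_cancel_of_le h1]
        rw [this, pow_succ' M (k + 1)]
        refine (ContinuousLinearMap.opNorm_comp_le _ _).trans ?_
        refine mul_le_mul ((hM₀ ⟨1, by simp⟩).trans (le_max_left _ _)) (ih _ ?_)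
          (norm_nonneg _) (by positivity)
        rw [tsub_le_iff_right]
        exact_mod_cast ht
  refine ⟨M, Real.log M, hM1, hlog, fun t => ?_⟩
  refine (key ⌊t⌋₊ t (Nat.lt_floor_add_one t).le).trans ?_
  rw [pow_succ', ← Real.rpow_natCast, Real.rpow_def_of_pos hMpos]
  have : ((⌊t⌋₊ : ℕ) : ℝ) ≤ t := by exact_mod_cast Nat.floor_le (zero_le : 0 ≤ t)
  gcongr

theorem C0Semigroup.continuous_uncurry [CompleteSpace X] (T : C0Semigroup X) :
    Continuous fun z : ℝ × X => T.op z.1.toNNReal z.2 := by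
  obtain ⟨M, ω, hM, hω, hb⟩ := T.exists_exp_bound
  rw [continuous_iff_continuousAt]
  rintro ⟨s, x⟩
  have h1 : Tendsto (fun z : ℝ × X => M * Real.exp (ω * (z.1.toNNReal : ℝ)) * ‖z.2 - x‖)
      (𝓝 (s, x)) (𝓝 0) := by
    have : Continuous fun z : ℝ × X => M * Real.exp (ω * (z.1.toNNReal : ℝ)) * ‖z.2 - x‖ := by
      fun_prop
    simpa using this.tendsto (s, x)
  have h2 : Tendsto (fun z : ℝ × X => T.op z.1.toNNReal (z.2 - x)) (𝓝 (s, x)) (𝓝 0) := by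
    refine squeeze_zero_norm (fun z => ?_) h1
    exact (ContinuousLinearMap.le_opNorm _ _).trans
      (mul_le_mul_of_nonneg_right (hb _) (norm_nonneg _))
  have h3 : Tendsto (fun z : ℝ × X => T.op z.1.toNNReal x) (𝓝 (s, x))
      (𝓝 (T.op s.toNNReal x)) := by
    have : Continuous fun z : ℝ × X => T.op z.1.toNNReal x :=
      (T.continuous_orbit x).comp (continuous_real_toNNReal.comp continuous_fst)
    exact this.tendsto (s, x)
  have := h2.add h3
  simp only [map_sub, sub_add_cancel, zero_add] at this
  exact this

theorem C0Semigroup.continuous_op_comp [CompleteSpace X] (T : C0Semigroup X) {Z : Type*}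
    [TopologicalSpace Z] {s : Z → ℝ} {g : Z → X} (hs : Continuous s) (hg : Continuous g) :
    Continuous fun z => T.op (s z).toNNReal (g z) :=
  T.continuous_uncurry.comp (hs.prodMk hg)

theorem C0Semigroup.mem_graph_op (T : C0Semigroup X) {x y : X}
    (h : (x, y) ∈ T.generator.graph) (t : ℝ≥0) : (T.op t x, T.op t y) ∈ T.generator.graph := by
  rw [T.mem_generator_graph_iff] at h ⊢
  refine (((T.op t).continuous.tendsto y).comp h).congr fun s => ?_
  simp only [Function.comp_apply, map_smul, map_sub]
  rw [T.op_comm]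

/-- The difference quotient at t is that of the generator at T(t)x. Only the right derivative comes
out directly, and it suffices for the fundamental theorem of calculus below. -/
theorem C0Semigroup.hasDerivWithinAt (T : C0Semigroup X) {x y : X}
    (h : (x, y) ∈ T.generator.graph) {t : ℝ} (ht : 0 ≤ t) :
    HasDerivWithinAt (fun s : ℝ => T.op s.toNNReal x) (T.op t.toNNReal y) (Ioi t) t := by
  have h' := (T.mem_generator_graph_iff _ _).1 (T.mem_graph_op h t.toNNReal)
  rw [hasDerivWithinAt_iff_tendsto_slope' (by simp)]
  have hτ : Tendsto (fun s : ℝ => (s - t).toNNReal) (𝓝[>] t) (𝓝[>] 0) := by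
    refine tendsto_nhdsWithin_iff.2 ⟨?_, ?_⟩
    · have : Continuous fun s : ℝ => (s - t).toNNReal := by fun_prop
      simpa using (this.tendsto t).mono_left nhdsWithin_le_nhds
    · filter_upwards [self_mem_nhdsWithin] with s hs
      simpa using hs
  refine (h'.comp hτ).congr' ?_
  filter_upwards [self_mem_nhdsWithin] with s hs
  have hs' : 0 ≤ s - t := by simpa using (le_of_lt hs : t ≤ s)
  simp only [Function.comp_apply, slope_def_module]
  rw [← T.op_add_apply, ← Real.toNNReal_add hs' ht, sub_add_cancel, Real.coe_toNNReal _ hs',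
    ← Complex.ofReal_inv, Complex.coe_smul]

end Semigroup

/-! ### Resolvent identity, continuity and holomorphy of the resolvent. -/

section Resolvent

variable {X : Type*} [NormedAddCommGroup X] [NormedSpace ℂ X] {A : X →ₗ.[ℂ] X}

theorem mem_graph_resolvent {μ : ℂ} (h : μ ∈ resolventSet A) (x : X) :
    (resolvent A μ x, μ • resolvent A μ x - x) ∈ A.graph := by
  obtain ⟨hd, hx⟩ := (resolvent_spec h).1 x
  rw [LinearPMap.mem_graph_iff]
  exact ⟨⟨_, hd⟩, rfl, (sub_eq_iff_eq_add'.2 (sub_eq_iff_eq_add.1 hx)).symm⟩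

theorem resolvent_apply_of_mem_graph {μ : ℂ} (h : μ ∈ resolventSet A) {x y : X}
    (hxy : (x, y) ∈ A.graph) : resolvent A μ (μ • x - y) = x := by
  rw [LinearPMap.mem_graph_iff] at hxy
  obtain ⟨z, rfl, rfl⟩ := hxy
  exact (resolvent_spec h).2 z

/-- Apply R(μ) to (μ - A)R(ν)x = x - (ν - μ)R(ν)x. -/
theorem resolvent_sub_resolvent {μ ν : ℂ} (hμ : μ ∈ resolventSet A) (hν : ν ∈ resolventSet A) :
    resolvent A μ - resolvent A ν = (ν - μ) • (resolvent A μ * resolvent A ν) := by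
  ext x
  have h := mem_graph_resolvent hν x
  have h2 := resolvent_apply_of_mem_graph hμ h
  have e : μ • resolvent A ν x - (ν • resolvent A ν x - x) = x - (ν - μ) • resolvent A ν x := by
    module
  rw [e, map_sub, map_smul] at h2
  change resolvent A μ x - resolvent A ν x = (ν - μ) • resolvent A μ (resolvent A ν x)
  rw [sub_eq_iff_eq_add'] at h2 ⊢
  rw [h2]
  abel

theorem C0Semigroup.op_resolvent (T : C0Semigroup X) {μ : ℂ}
    (h : μ ∈ resolventSet T.generator) (t : ℝ≥0) (x : X) :
    T.op t (resolvent T.generator μ x) = resolvent T.generator μ (T.op t x) := by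
  have := resolvent_apply_of_mem_graph h (T.mem_graph_op (mem_graph_resolvent h x) t)
  rw [← this, ← map_smul, ← map_sub]
  simp

/-- The resolvent is continuous on sets where it is locally bounded. -/
theorem continuousOn_resolvent {s : Set ℂ} (hs : s ⊆ resolventSet A)
    {b : ℂ → ℝ} (hb : ContinuousOn b s) (hbd : ∀ μ ∈ s, ‖resolvent A μ‖ ≤ b μ) :
    ContinuousOn (resolvent A) s := by
  intro μ hμ
  rw [ContinuousWithinAt, tendsto_iff_norm_sub_tendsto_zero]
  have h1 : Tendsto (fun ν => ‖μ - ν‖ * (b ν * b μ)) (𝓝[s] μ) (𝓝 0) := by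
    have hc : ContinuousWithinAt (fun ν => ‖μ - ν‖ * (b ν * b μ)) s μ := by
      have := hb μ hμ
      fun_prop
    simpa using hc.tendsto
  refine squeeze_zero' (Eventually.of_forall fun _ => norm_nonneg _) ?_ h1
  filter_upwards [self_mem_nhdsWithin] with ν hν
  rw [resolvent_sub_resolvent (hs hν) (hs hμ), norm_smul]
  have h0 : 0 ≤ b ν := (norm_nonneg _).trans (hbd ν hν)
  gcongr
  exact (norm_mul_le _ _).trans (mul_le_mul (hbd ν hν) (hbd μ hμ) (norm_nonneg _) h0)

theorem hasDerivAt_resolvent {s : Set ℂ} (hs : s ⊆ resolventSet A)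
    (hc : ContinuousOn (resolvent A) s) {μ : ℂ} (hμ : s ∈ 𝓝 μ) :
    HasDerivAt (resolvent A) (-(resolvent A μ * resolvent A μ)) μ := by
  rw [hasDerivAt_iff_tendsto_slope]
  have hcμ : ContinuousAt (resolvent A) μ := hc.continuousAt hμ
  have h1 : Tendsto (fun ν => -(resolvent A ν * resolvent A μ)) (𝓝[≠] μ)
      (𝓝 (-(resolvent A μ * resolvent A μ))) :=
    ((hcμ.tendsto.mono_left nhdsWithin_le_nhds).mul tendsto_const_nhds).neg
  refine h1.congr' ?_
  filter_upwards [self_mem_nhdsWithin, nhdsWithin_le_nhds hμ] with ν hν hνs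
  rw [slope_def_module, resolvent_sub_resolvent (hs hνs) (hs (mem_of_mem_nhds hμ)), smul_smul,
    ← neg_sub ν μ, mul_neg, inv_mul_cancel₀ (sub_ne_zero.2 hν)]
  simp

end Resolvent

/-! ### Powers of the resolvent as Laplace transforms; the Hille–Yosida bound. -/

section Laplace

open scoped Nat

/-- The kernel `s ↦ s^k / k! · e^{-μ s}`. -/
noncomputable def laplaceKernel (k : ℕ) (μ : ℂ) (s : ℝ) : ℂ :=
  ((s ^ k / k ! : ℝ) : ℂ) * Complex.exp (-(μ * s))

theorem continuous_laplaceKernel (k : ℕ) (μ : ℂ) : Continuous (laplaceKernel k μ) := by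
  unfold laplaceKernel
  fun_prop

theorem norm_laplaceKernel (k : ℕ) (μ : ℂ) {s : ℝ} (hs : 0 ≤ s) :
    ‖laplaceKernel k μ s‖ = s ^ k / k ! * Real.exp (-(μ.re * s)) := by
  rw [laplaceKernel, norm_mul, Complex.norm_exp, Complex.norm_real, Real.norm_of_nonneg (by positivity)]
  simp

theorem integrableOn_pow_mul_exp_neg (k : ℕ) {c : ℝ} (hc : 0 < c) :
    IntegrableOn (fun s : ℝ => s ^ k / k ! * Real.exp (-(c * s))) (Ioi 0) := by
  have : IntegrableOn (fun s : ℝ => s ^ (k : ℝ) * Real.exp (-c * s ^ (1 : ℝ)) / k !) (Ioi 0) :=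
    (integrableOn_rpow_mul_exp_neg_mul_rpow (p := 1) (s := k) (b := c)
    (by have : (0 : ℝ) ≤ k := by positivity
        linarith) one_pos hc).div_const (k ! : ℝ)
  refine this.congr_fun (fun s hs => ?_) measurableSet_Ioi
  simp only [Real.rpow_natCast, Real.rpow_one]
  ring_nf

theorem tendsto_pow_mul_exp_neg (k : ℕ) {c : ℝ} (hc : 0 < c) :
    Tendsto (fun s : ℝ => s ^ k / k ! * Real.exp (-(c * s))) atTop (𝓝 0) := by
  have := (tendsto_rpow_mul_exp_neg_mul_atTop_nhds_zero k c hc).div_const (k ! : ℝ)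
  rw [zero_div] at this
  refine this.congr fun s => ?_
  simp only [Real.rpow_natCast]
  ring_nf

theorem hasDerivAt_laplaceKernel_zero (μ : ℂ) (s : ℝ) :
    HasDerivAt (laplaceKernel 0 μ) (-(μ * laplaceKernel 0 μ s)) s := by
  have h : HasDerivAt (fun s : ℝ => -(μ * (s : ℂ))) (-μ) s := by
    have h0 := ((hasDerivAt_id s).ofReal_comp.const_mul μ).neg
    simp only [Complex.ofReal_one, mul_one] at h0
    exact h0
  have h2 := h.cexp
  unfold laplaceKernel
  simp only [pow_zero, Nat.factorial_zero, Nat.cast_one, div_one, Complex.ofReal_one, one_mul]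
  convert h2 using 1
  ring

theorem hasDerivAt_laplaceKernel_succ (k : ℕ) (μ : ℂ) (s : ℝ) :
    HasDerivAt (laplaceKernel (k + 1) μ)
      (laplaceKernel k μ s - μ * laplaceKernel (k + 1) μ s) s := by
  have h : HasDerivAt (fun s : ℝ => -(μ * (s : ℂ))) (-μ) s := by
    have h0 := ((hasDerivAt_id s).ofReal_comp.const_mul μ).neg
    simp only [Complex.ofReal_one, mul_one] at h0
    exact h0
  have h1 : HasDerivAt (fun s : ℝ => ((s ^ (k + 1) / (k + 1)! : ℝ) : ℂ))
      ((s ^ k / k ! : ℝ) : ℂ) s := by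
    have h0 := ((hasDerivAt_pow (k + 1) s).div_const ((k + 1)! : ℝ)).ofReal_comp
    refine h0.congr_deriv ?_
    rw [Nat.factorial_succ, add_tsub_cancel_right]
    have : (k ! : ℝ) ≠ 0 := by positivity
    push_cast
    field_simp
  have h2 := h1.mul h.cexp
  unfold laplaceKernel
  refine h2.congr_deriv ?_
  ring

theorem integral_Ioi_of_hasDerivWithinAt {E : Type*} [NormedAddCommGroup E] [NormedSpace ℝ E]
    [CompleteSpace E] {F F' : ℝ → E} (hc : Continuous F)
    (hd : ∀ s, 0 < s → HasDerivWithinAt F (F' s) (Ioi s) s) (hi : IntegrableOn F' (Ioi 0))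
    (hl : Tendsto F atTop (𝓝 0)) : ∫ s in Ioi 0, F' s = -F 0 := by
  have h1 := intervalIntegral_tendsto_integral_Ioi 0 hi tendsto_id
  have h2 : Tendsto (fun N : ℝ => F N - F 0) atTop (𝓝 (0 - F 0)) := hl.sub_const _
  rw [← zero_sub]
  refine tendsto_nhds_unique h1 (h2.congr' ?_)
  filter_upwards [eventually_ge_atTop 0] with N hN
  rw [id, intervalIntegral.integral_eq_sub_of_hasDeriv_right_of_le hN hc.continuousOn
    (fun s hs => hd s hs.1)]
  rw [intervalIntegrable_iff_integrableOn_Ioc_of_le hN]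
  exact hi.mono_set Ioc_subset_Ioi_self

variable {X : Type*} [NormedAddCommGroup X] [NormedSpace ℂ X]

theorem C0Semigroup.integrableOn_laplaceKernel_smul [CompleteSpace X] (T : C0Semigroup X) (k : ℕ) {μ : ℂ} {z : X}
    {M b : ℝ} (hb : b < μ.re)
    (hz : ∀ s : ℝ, 0 ≤ s → ‖T.op s.toNNReal z‖ ≤ M * Real.exp (b * s)) :
    IntegrableOn (fun s => laplaceKernel k μ s • T.op s.toNNReal z) (Ioi 0) := by
  refine ((integrableOn_pow_mul_exp_neg k (sub_pos.2 hb)).mul_const M).mono' ?_ ?_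
  · exact ((continuous_laplaceKernel k μ).smul
      (T.continuous_op_comp continuous_id continuous_const)).aestronglyMeasurable
  · filter_upwards [ae_restrict_mem measurableSet_Ioi] with s hs
    have hs0 : 0 ≤ s := le_of_lt hs
    rw [norm_smul, norm_laplaceKernel _ _ hs0]
    calc _ ≤ s ^ k / k ! * Real.exp (-(μ.re * s)) * (M * Real.exp (b * s)) := by
          gcongr
          exact hz s hs0
      _ = s ^ k / k ! * (Real.exp (-(μ.re * s)) * Real.exp (b * s)) * M := by ring
      _ = _ := by rw [← Real.exp_add]; ring_nf

theorem C0Semigroup.tendsto_laplaceKernel_smul (T : C0Semigroup X) (k : ℕ) {μ : ℂ} {z : X}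
    {M b : ℝ} (hb : b < μ.re)
    (hz : ∀ s : ℝ, 0 ≤ s → ‖T.op s.toNNReal z‖ ≤ M * Real.exp (b * s)) :
    Tendsto (fun s => laplaceKernel k μ s • T.op s.toNNReal z) atTop (𝓝 0) := by
  have h := (tendsto_pow_mul_exp_neg k (sub_pos.2 hb)).mul_const M
  rw [zero_mul] at h
  refine squeeze_zero_norm' ?_ h
  filter_upwards [eventually_ge_atTop 0] with s hs0
  rw [norm_smul, norm_laplaceKernel _ _ hs0]
  calc _ ≤ s ^ k / k ! * Real.exp (-(μ.re * s)) * (M * Real.exp (b * s)) := by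
        gcongr
        exact hz s hs0
    _ = s ^ k / k ! * (Real.exp (-(μ.re * s)) * Real.exp (b * s)) * M := by ring
    _ = _ := by rw [← Real.exp_add]; ring_nf

theorem C0Semigroup.norm_op_resolvent_le (T : C0Semigroup X) {μ : ℂ}
    (hμ : μ ∈ resolventSet T.generator) {z : X} {M b : ℝ}
    (hz : ∀ s : ℝ, 0 ≤ s → ‖T.op s.toNNReal z‖ ≤ M * Real.exp (b * s)) (s : ℝ) (hs : 0 ≤ s) :
    ‖T.op s.toNNReal (resolvent T.generator μ z)‖ ≤
      (‖resolvent T.generator μ‖ * M) * Real.exp (b * s) := by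
  rw [T.op_resolvent hμ, mul_assoc]
  exact (ContinuousLinearMap.le_opNorm _ _).trans
    (mul_le_mul_of_nonneg_left (hz s hs) (norm_nonneg _))

/-- Powers of the resolvent as Laplace transforms of orbits. -/
theorem C0Semigroup.resolvent_pow_eq_integral [CompleteSpace X] (T : C0Semigroup X) {μ : ℂ}
    (hμ : μ ∈ resolventSet T.generator) (k : ℕ) {z : X} {M b : ℝ} (hb : b < μ.re)
    (hz : ∀ s : ℝ, 0 ≤ s → ‖T.op s.toNNReal z‖ ≤ M * Real.exp (b * s)) :
    (resolvent T.generator μ ^ (k + 1)) z =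
      ∫ s in Ioi (0 : ℝ), laplaceKernel k μ s • T.op s.toNNReal z := by
  set R := resolvent T.generator μ with hR
  have hg : ∀ z : X, (R z, μ • R z - z) ∈ T.generator.graph := mem_graph_resolvent hμ
  induction k generalizing z M with
  | zero =>
    have hRz := T.norm_op_resolvent_le hμ hz
    -- As A R z = μ R z - z, the function e^{-μs} T(s)Rz is an antiderivative of -e^{-μs} T(s)z.
    have h := integral_Ioi_of_hasDerivWithinAt
      (F := fun s => laplaceKernel 0 μ s • T.op s.toNNReal (R z))
      (F' := fun s => -(laplaceKernel 0 μ s • T.op s.toNNReal z))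
      ((continuous_laplaceKernel 0 μ).smul (T.continuous_op_comp continuous_id continuous_const))
      (fun s hs => by
        have h1 := (hasDerivAt_laplaceKernel_zero μ s).hasDerivWithinAt.smul
          (T.hasDerivWithinAt (hg z) hs.le)
        refine h1.congr_deriv ?_
        rw [map_sub, map_smul]
        module)
      (T.integrableOn_laplaceKernel_smul 0 hb hz).neg
      (T.tendsto_laplaceKernel_smul 0 hb hRz)
    rw [integral_neg, neg_inj] at h
    rw [h]
    simp [laplaceKernel, T.op_zero]
  | succ k ih =>
    have hRz := T.norm_op_resolvent_le hμ hz
    have i1 := T.integrableOn_laplaceKernel_smul k hb hRz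
    have i2 := T.integrableOn_laplaceKernel_smul (k + 1) hb hz
    -- Integration by parts: the integral with kernel index k + 1 at z equals the one with index k
    -- at Rz, because the boundary term at 0 vanishes.
    have h := integral_Ioi_of_hasDerivWithinAt
      (F := fun s => laplaceKernel (k + 1) μ s • T.op s.toNNReal (R z))
      (F' := fun s => laplaceKernel k μ s • T.op s.toNNReal (R z) -
        laplaceKernel (k + 1) μ s • T.op s.toNNReal z)
      ((continuous_laplaceKernel _ μ).smul (T.continuous_op_comp continuous_id continuous_const))
      (fun s hs => by
        have h1 := (hasDerivAt_laplaceKernel_succ k μ s).hasDerivWithinAt.smul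
          (T.hasDerivWithinAt (hg z) hs.le)
        refine h1.congr_deriv ?_
        rw [map_sub, map_smul]
        module)
      (i1.sub i2)
      (T.tendsto_laplaceKernel_smul _ hb hRz)
    rw [integral_sub i1 i2] at h
    have h0 : laplaceKernel (k + 1) μ 0 • T.op (0 : ℝ).toNNReal (R z) = 0 := by
      simp [laplaceKernel]
    rw [h0, neg_zero, sub_eq_zero] at h
    rw [← h, ← ih hRz, pow_succ]
    rfl

/-- The Hille–Yosida bound. -/
theorem C0Semigroup.norm_resolvent_le [CompleteSpace X] (T : C0Semigroup X) {M ω : ℝ}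
    (hT : ∀ t : ℝ≥0, ‖T.op t‖ ≤ M * Real.exp (ω * t)) {μ : ℂ}
    (hμ : μ ∈ resolventSet T.generator) (h : ω < μ.re) :
    ‖resolvent T.generator μ‖ ≤ M / (μ.re - ω) := by
  have hM : 0 ≤ M := by simpa using (norm_nonneg _).trans (hT 0)
  refine ContinuousLinearMap.opNorm_le_bound _ (div_nonneg hM (sub_pos.2 h).le) fun z => ?_
  have hz : ∀ s : ℝ, 0 ≤ s → ‖T.op s.toNNReal z‖ ≤ (M * ‖z‖) * Real.exp (ω * s) := by
    intro s hs
    calc _ ≤ ‖T.op s.toNNReal‖ * ‖z‖ := ContinuousLinearMap.le_opNorm _ _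
      _ ≤ M * Real.exp (ω * s.toNNReal) * ‖z‖ := by gcongr; exact hT _
      _ = _ := by rw [Real.coe_toNNReal _ hs]; ring
  have e := T.resolvent_pow_eq_integral hμ 0 h hz
  rw [zero_add, pow_one] at e
  rw [e]
  refine (norm_integral_le_of_norm_le
    ((integrableOn_pow_mul_exp_neg 0 (sub_pos.2 h)).mul_const (M * ‖z‖)) ?_).trans_eq ?_
  · filter_upwards [ae_restrict_mem measurableSet_Ioi] with s hs
    have hs0 : 0 ≤ s := le_of_lt hs
    rw [norm_smul, norm_laplaceKernel _ _ hs0]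
    calc _ ≤ s ^ 0 / 0 ! * Real.exp (-(μ.re * s)) * (M * ‖z‖ * Real.exp (ω * s)) := by
          gcongr
          exact hz s hs0
      _ = s ^ 0 / 0 ! * (Real.exp (-(μ.re * s)) * Real.exp (ω * s)) * (M * ‖z‖) := by ring
      _ = _ := by rw [← Real.exp_add]; ring_nf
  · rw [integral_mul_const]
    have := integral_exp_mul_Ioi (a := -(μ.re - ω)) (by linarith) 0
    simp only [mul_zero, Real.exp_zero] at this
    simp only [pow_zero, Nat.factorial_zero, Nat.cast_one, div_one, one_mul, ← neg_mul]
    rw [this]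
    field_simp

end Laplace

/-! ### Fourier transforms of Schwartz functions and the convolution formula on vertical lines. -/

section Fourier

open scoped Nat FourierTransform

variable {X Y : Type*} [NormedAddCommGroup X] [NormedSpace ℂ X]
  [NormedAddCommGroup Y] [NormedSpace ℂ Y]

theorem fourier_eq_fourierTransform (f : ℝ → X) (ξ : ℝ) :
    fourier f ξ = 𝓕 f (ξ * (2 * Real.pi)⁻¹) := by
  rw [Real.fourier_real_eq_integral_exp_smul, fourier]
  congr 1
  ext x
  congr 2
  have : (Real.pi : ℂ) ≠ 0 := by exact_mod_cast Real.pi_ne_zero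
  push_cast
  field_simp

theorem fourierInv_eq_fourierTransformInv (g : ℝ → X) (t : ℝ) :
    fourierInv g t = 𝓕⁻ (fun η => g (2 * Real.pi * η)) t := by
  rw [Real.fourierInv_eq', fourierInv]
  have hpi : (0 : ℝ) < 2 * Real.pi := by positivity
  have h := Measure.integral_comp_mul_left
    (fun ξ : ℝ => Complex.exp (Complex.I * t * ξ) • g ξ) (2 * Real.pi)
  rw [abs_of_pos (inv_pos.2 hpi)] at h
  rw [← h]
  congr 1
  ext x
  congr 2
  simp
  ring

theorem fourierInv_fourier [CompleteSpace X] (g : 𝓢(ℝ, X)) (t : ℝ) :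
    fourierInv (fourier g) t = g t := by
  rw [fourierInv_eq_fourierTransformInv]
  have : (fun η => fourier g (2 * Real.pi * η)) = 𝓕 (g : ℝ → X) := by
    ext η
    rw [fourier_eq_fourierTransform]
    field_simp
  rw [this, g.continuous.fourierInv_fourier_eq g.integrable]
  have := (𝓕 g).integrable (μ := volume)
  rwa [SchwartzMap.fourier_coe] at this

theorem continuous_fourier [CompleteSpace X] (g : 𝓢(ℝ, X)) : Continuous (fourier g) := by
  have h : fourier g = fun ξ => (𝓕 g) (ξ * (2 * Real.pi)⁻¹) := by
    ext ξ
    rw [fourier_eq_fourierTransform, SchwartzMap.fourier_coe]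
  rw [h]
  exact (𝓕 g).continuous.comp (by fun_prop)

theorem exists_fourier_decay [CompleteSpace X] (g : 𝓢(ℝ, X)) (N : ℕ) :
    ∃ C, 0 ≤ C ∧ ∀ ξ : ℝ, ‖fourier g ξ‖ * (1 + |ξ|) ^ N ≤ C := by
  have key : ∀ k : ℕ, ∃ C, ∀ ξ : ℝ, |ξ| ^ k * ‖fourier g ξ‖ ≤ C := by
    intro k
    obtain ⟨C, hC⟩ := (𝓕 g).decay k 0
    refine ⟨(2 * Real.pi) ^ k * C, fun ξ => ?_⟩
    have := hC.2 (ξ * (2 * Real.pi)⁻¹)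
    rw [norm_iteratedFDeriv_zero, SchwartzMap.fourier_coe, ← fourier_eq_fourierTransform,
      norm_mul, norm_inv, Real.norm_eq_abs, Real.norm_of_nonneg (by positivity), mul_pow,
      inv_pow] at this
    have hpi : (0 : ℝ) < (2 * Real.pi) ^ k := by positivity
    calc _ = (2 * Real.pi) ^ k * (|ξ| ^ k * ((2 * Real.pi) ^ k)⁻¹ * ‖fourier g ξ‖) := by
          field_simp
      _ ≤ _ := by gcongr
  obtain ⟨C₀, h₀⟩ := key 0
  obtain ⟨C₁, h₁⟩ := key N
  have hN : ∀ ξ : ℝ, ‖fourier g ξ‖ * (1 + |ξ|) ^ N ≤ 2 ^ N * (C₀ + C₁) := by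
    intro ξ
    have h2 : (1 + |ξ|) ^ N ≤ 2 ^ N * (1 + |ξ| ^ N) := by
      rcases le_total |ξ| 1 with h | h
      · calc (1 + |ξ|) ^ N ≤ 2 ^ N := by gcongr; linarith
          _ ≤ _ := le_mul_of_one_le_right (by positivity) (by simp)
      · calc (1 + |ξ|) ^ N ≤ (2 * |ξ|) ^ N := by gcongr; linarith
          _ = 2 ^ N * |ξ| ^ N := mul_pow _ _ _
          _ ≤ _ := by gcongr; linarith
    have e0 := h₀ ξ
    rw [pow_zero, one_mul] at e0
    calc _ ≤ ‖fourier g ξ‖ * (2 ^ N * (1 + |ξ| ^ N)) := by gcongr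
      _ = 2 ^ N * (‖fourier g ξ‖ + |ξ| ^ N * ‖fourier g ξ‖) := by ring
      _ ≤ _ := by gcongr; exact h₁ ξ
  exact ⟨_, le_trans (by positivity) (hN 0), hN⟩

theorem integrable_fourier_mul_pow [CompleteSpace X] (g : 𝓢(ℝ, X)) (N : ℕ) :
    Integrable fun ξ : ℝ => ‖fourier g ξ‖ * (1 + |ξ|) ^ N := by
  -- The two extra powers leave the integrable majorant (1 + ξ²)⁻¹.
  obtain ⟨C, hC, h⟩ := exists_fourier_decay g (N + 2)
  refine (integrable_inv_one_add_sq.const_mul C).mono'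
    ((continuous_fourier g).norm.mul (by fun_prop)).aestronglyMeasurable (.of_forall fun ξ => ?_)
  rw [Real.norm_of_nonneg (by positivity), ← div_eq_mul_inv, le_div_iff₀ (by positivity)]
  refine le_trans ?_ (h ξ)
  rw [pow_add, ← mul_assoc]
  gcongr
  nlinarith [abs_nonneg ξ, sq_abs ξ]

theorem integrable_fourier [CompleteSpace X] (g : 𝓢(ℝ, X)) : Integrable (fourier g) := by
  have := integrable_fourier_mul_pow g 0
  simp only [pow_zero, mul_one] at this
  exact (integrable_norm_iff (continuous_fourier g).aestronglyMeasurable).1 this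

theorem fourier_clm_comp [CompleteSpace X] [CompleteSpace Y] (L : X →L[ℂ] Y) (g : 𝓢(ℝ, X))
    (ξ : ℝ) : fourier (fun x => L (g x)) ξ = L (fourier g ξ) := by
  unfold fourier
  rw [← ContinuousLinearMap.integral_comp_comm]
  · simp
  · refine (integrable_norm_iff ?_).1 ?_
    · exact (Continuous.smul (by fun_prop) g.continuous).aestronglyMeasurable
    · refine (g.integrable (μ := volume)).norm.congr (.of_forall fun x => ?_)
      simp [norm_smul, Complex.norm_exp]

/-- Multipliers can be composed with bounded operators. -/
theorem IsBoundedMultiplier.comp {Z : Type*} [NormedAddCommGroup Z] [NormedSpace ℂ Z]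
    [CompleteSpace Y] [CompleteSpace Z] {p q : ℝ≥0∞} {m : ℝ → Y →L[ℂ] X}
    (hm : IsBoundedMultiplier p q m) (L : Z →L[ℂ] Y) :
    IsBoundedMultiplier p q fun ξ => (m ξ).comp L := by
  obtain ⟨C, hC⟩ := hm
  refine ⟨C * ‖L‖₊, fun f => ?_⟩
  have h := hC (f.postcompCLM L)
  have e : ∀ ξ, fourier (f.postcompCLM L) ξ = L (fourier f ξ) := fourier_clm_comp L f
  have h1 := h.1
  simp only [e] at h1
  refine ⟨h1, ?_⟩
  have e2 : multiplierOp (fun ξ => (m ξ).comp L) f = multiplierOp m (f.postcompCLM L) := by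
    unfold multiplierOp
    simp only [e]
    rfl
  rw [e2]
  refine h.2.trans ?_
  rw [ENNReal.coe_mul, mul_assoc]
  gcongr
  exact eLpNorm_le_nnreal_smul_eLpNorm_of_ae_le_mul (.of_forall fun x => L.le_opNNNorm (f x)) p

theorem laplaceKernel_add (k : ℕ) (a ξ s : ℝ) :
    laplaceKernel k (a + Complex.I * ξ) s =
      Complex.exp (-(Complex.I * ξ * s)) * laplaceKernel k a s := by
  unfold laplaceKernel
  rw [mul_left_comm, ← Complex.exp_add]
  ring_nf

/-- On the line `Re λ = a`, the multiplier with symbol `R(λ)^{k+1} S` is a convolution. -/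
theorem C0Semigroup.fourierInv_resolvent_pow [CompleteSpace X] (T : C0Semigroup X) {a b M : ℝ}
    (S : X →L[ℂ] X)
    (hS : ∀ s : ℝ, 0 ≤ s → ∀ x, ‖T.op s.toNNReal (S x)‖ ≤ M * Real.exp (b * s) * ‖x‖)
    (hb : b < a) (hρ : ∀ ξ : ℝ, (a + Complex.I * ξ : ℂ) ∈ resolventSet T.generator) (k : ℕ)
    (g : 𝓢(ℝ, X)) (t : ℝ) :
    fourierInv (fun ξ =>
      (resolvent T.generator (a + Complex.I * ξ) ^ (k + 1)) (S (fourier g ξ))) t =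
      ∫ s in Ioi (0 : ℝ), laplaceKernel k a s • T.op s.toNNReal (S (g (t - s))) := by
  have e1 : ∀ ξ : ℝ, Complex.exp (Complex.I * t * ξ) •
      (resolvent T.generator (a + Complex.I * ξ) ^ (k + 1)) (S (fourier g ξ)) =
      ∫ s in Ioi (0 : ℝ), Complex.exp (Complex.I * t * ξ) • laplaceKernel k (a + Complex.I * ξ) s •
        T.op s.toNNReal (S (fourier g ξ)) := by
    intro ξ
    rw [T.resolvent_pow_eq_integral (hρ ξ) k (M := M * ‖fourier g ξ‖) (b := b) (by simpa using hb),
      integral_smul]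
    intro s hs
    exact (hS s hs _).trans_eq (by ring)
  have hM : ∀ s : ℝ, 0 ≤ s → ∀ x, ‖laplaceKernel k a s • T.op s.toNNReal (S x)‖ ≤
      ‖x‖ * (s ^ k / k ! * Real.exp (-((a - b) * s)) * M) := by
    intro s hs x
    rw [norm_smul, norm_laplaceKernel _ _ hs, Complex.ofReal_re]
    calc _ ≤ s ^ k / k ! * Real.exp (-(a * s)) * (M * Real.exp (b * s) * ‖x‖) := by
          gcongr
          exact hS s hs x
      _ = ‖x‖ * (s ^ k / k ! * (Real.exp (-(a * s)) * Real.exp (b * s)) * M) := by ring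
      _ = _ := by rw [← Real.exp_add]; ring_nf
  -- Absolute integrability for Fubini: 𝓕g is integrable in ξ, and b < a leaves the factor
  -- e^{-(a-b)s} in s.
  have hint : Integrable (Function.uncurry fun (ξ s : ℝ) => Complex.exp (Complex.I * t * ξ) •
      laplaceKernel k (a + Complex.I * ξ) s • T.op s.toNNReal (S (fourier g ξ)))
      (volume.prod (volume.restrict (Ioi 0))) := by
    have hdom := (integrable_fourier g).norm.mul_prod
      ((integrableOn_pow_mul_exp_neg k (sub_pos.2 hb)).mul_const M)
    refine hdom.mono' ?_ ?_
    · refine Continuous.aestronglyMeasurable ?_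
      simp only [laplaceKernel_add, Function.uncurry_def]
      have h1 := (continuous_laplaceKernel k a).comp (continuous_snd (X := ℝ) (Y := ℝ))
      have h2 := T.continuous_op_comp (continuous_snd (X := ℝ) (Y := ℝ))
        (S.continuous.comp ((continuous_fourier g).comp continuous_fst))
      exact Continuous.smul (by fun_prop) (Continuous.smul (Continuous.mul (by fun_prop) h1) h2)
    · have : ∀ᵐ z : ℝ × ℝ ∂(volume.prod (volume.restrict (Ioi 0))), z.2 ∈ Ioi (0 : ℝ) :=
        Measure.quasiMeasurePreserving_snd.ae (ae_restrict_mem measurableSet_Ioi)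
      filter_upwards [this] with z hz
      refine le_trans (le_of_eq ?_) (hM z.2 (le_of_lt hz) (fourier g z.1))
      simp only [Function.uncurry_def, laplaceKernel_add, norm_smul, norm_mul, Complex.norm_exp]
      simp
  rw [fourierInv]
  simp_rw [e1]
  rw [integral_integral_swap hint, ← integral_smul]
  refine integral_congr_ae (.of_forall fun s => ?_)
  -- The oscillating part e^{-iξs} of the kernel turns e^{itξ} into e^{i(t-s)ξ}, so Fourier
  -- inversion returns g(t - s).
  have e2 : ∀ ξ : ℝ, Complex.exp (Complex.I * t * ξ) • laplaceKernel k (a + Complex.I * ξ) s •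
        T.op s.toNNReal (S (fourier g ξ)) = (laplaceKernel k a s • (T.op s.toNNReal).comp S)
        (Complex.exp (Complex.I * (t - s : ℝ) * ξ) • fourier g ξ) := by
    intro ξ
    rw [laplaceKernel_add, map_smul]
    simp only [FunLike.coe_smul, Pi.smul_apply, ContinuousLinearMap.comp_apply, smul_smul]
    congr 1
    have : Complex.exp (Complex.I * (t - s : ℝ) * ξ) =
        Complex.exp (Complex.I * t * ξ) * Complex.exp (-(Complex.I * ξ * s)) := by
      rw [← Complex.exp_add]
      congr 1
      push_cast
      ring
    rw [this]
    ring
  simp only [e2]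
  rw [ContinuousLinearMap.integral_comp_comm, ← ContinuousLinearMap.map_smul_of_tower]
  · have := fourierInv_fourier g (t - s)
    rw [fourierInv] at this
    rw [this]
    rfl
  · refine (integrable_norm_iff ?_).1 ?_
    · exact (Continuous.smul (by fun_prop) (continuous_fourier g)).aestronglyMeasurable
    · refine (integrable_fourier g).norm.congr (.of_forall fun x => ?_)
      simp [norm_smul, Complex.norm_exp]

end Fourier

/-! ### From polynomial decay to multiplier bounds. -/

section Decay

open scoped Nat

variable {X : Type*} [NormedAddCommGroup X] [NormedSpace ℂ X]

theorem exists_nat_growth {A : X →ₗ.[ℂ] X}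
    (hgrowth : ∃ β C' : ℝ, 0 ≤ β ∧ 0 ≤ C' ∧ ∀ μ : ℂ, 0 ≤ μ.re →
      ‖resolvent A μ‖ ≤ C' * (1 + ‖μ‖) ^ β) :
    ∃ (D : ℝ) (N : ℕ), 0 ≤ D ∧ ∀ μ : ℂ, 0 ≤ μ.re → ‖resolvent A μ‖ ≤ D * (1 + ‖μ‖) ^ N := by
  obtain ⟨β, D, -, hD, h⟩ := hgrowth
  refine ⟨D, ⌈β⌉₊, hD, fun μ hμ => (h μ hμ).trans ?_⟩
  rw [← Real.rpow_natCast]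
  gcongr
  · linarith [norm_nonneg μ]
  · exact Nat.le_ceil β

theorem continuousOn_resolvent_of_growth {A : X →ₗ.[ℂ] X}
    (hρ : ∀ μ : ℂ, 0 ≤ μ.re → μ ∈ resolventSet A) {D : ℝ} {N : ℕ}
    (hD : ∀ μ : ℂ, 0 ≤ μ.re → ‖resolvent A μ‖ ≤ D * (1 + ‖μ‖) ^ N) :
    ContinuousOn (resolvent A) {μ | 0 ≤ μ.re} :=
  continuousOn_resolvent (s := {μ | 0 ≤ μ.re}) hρ (b := fun μ => D * (1 + ‖μ‖) ^ N)
    (by fun_prop) hD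

theorem norm_resolvent_pow_le {A : X →ₗ.[ℂ] X} {D : ℝ} {N : ℕ} (hD0 : 0 ≤ D)
    (hD : ∀ μ : ℂ, 0 ≤ μ.re → ‖resolvent A μ‖ ≤ D * (1 + ‖μ‖) ^ N) (k : ℕ) {r a : ℝ}
    (hr : 0 ≤ r) (hra : r ≤ a) (ξ : ℝ) :
    ‖resolvent A (r + Complex.I * ξ) ^ (k + 1)‖ ≤
      (D * (1 + a) ^ N) ^ (k + 1) * (1 + |ξ|) ^ (N * (k + 1)) := by
  refine (norm_pow_le' _ (Nat.succ_pos k)).trans ?_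
  rw [pow_mul, ← mul_pow]
  refine pow_le_pow_left₀ (norm_nonneg _) ((hD _ (by simpa using hr)).trans ?_) _
  rw [mul_assoc, ← mul_pow]
  have h1 : ‖(r + Complex.I * ξ : ℂ)‖ ≤ r + |ξ| := by
    refine (norm_add_le _ _).trans_eq ?_
    simp [abs_of_nonneg hr]
  gcongr
  nlinarith [abs_nonneg ξ]

theorem continuous_resolvent_line {A : X →ₗ.[ℂ] X}
    (hc : ContinuousOn (resolvent A) {μ | 0 ≤ μ.re}) {r : ℝ} (hr : 0 ≤ r) :
    Continuous fun ξ : ℝ => resolvent A (r + Complex.I * ξ) :=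
  hc.comp_continuous (by fun_prop) (by simp [hr])

variable [CompleteSpace X]

/-- On [0, 1] the exponential bound for T suffices; for s ≥ 1 one has s^k ≤ s^n, which the decay
cancels. -/
theorem C0Semigroup.exists_kernel_bound (T : C0Semigroup X) (S : X →L[ℂ] X) {n : ℕ} {C : ℝ}
    (hC : 0 ≤ C)
    (hdec : ∀ (x : X) (t : ℝ≥0), 1 ≤ t → ‖T.op t (S x)‖ ≤ C * (t : ℝ) ^ (-(n : ℤ)) * ‖x‖)
    {k : ℕ} (hk : k ≤ n) :
    ∃ M, 0 ≤ M ∧ ∀ s : ℝ, 0 ≤ s → ∀ x, s ^ k / k ! * ‖T.op s.toNNReal (S x)‖ ≤ M * ‖x‖ := by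
  obtain ⟨M, ω, hM, hω, hT⟩ := T.exists_exp_bound
  refine ⟨M * Real.exp ω * ‖S‖ + C, by positivity, fun s hs x => ?_⟩
  have hdiv : s ^ k / k ! ≤ s ^ k :=
    div_le_self (by positivity) (by exact_mod_cast Nat.one_le_iff_ne_zero.2 k.factorial_ne_zero)
  rw [add_mul]
  rcases le_total s 1 with h1 | h1
  · refine le_trans ?_ (le_add_of_nonneg_right (by positivity))
    have hs1 : s ^ k / k ! ≤ 1 := hdiv.trans (pow_le_one₀ hs h1)
    calc _ ≤ 1 * (M * Real.exp (ω * s.toNNReal) * (‖S‖ * ‖x‖)) := by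
          gcongr
          exact ((T.op _).le_opNorm _).trans
            (mul_le_mul (hT _) (S.le_opNorm x) (norm_nonneg _) (by positivity))
      _ ≤ 1 * (M * Real.exp ω * (‖S‖ * ‖x‖)) := by
          gcongr
          rw [Real.coe_toNNReal _ hs]
          exact mul_le_of_le_one_right hω h1
      _ = _ := by ring
  · refine le_trans ?_ (le_add_of_nonneg_left (by positivity))
    have hs0 : 0 < s := by linarith
    have h := hdec x s.toNNReal (by rwa [Real.one_le_toNNReal])
    rw [Real.coe_toNNReal _ hs] at h
    calc _ ≤ s ^ n * (C * s ^ (-(n : ℤ)) * ‖x‖) := by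
          gcongr
          exact hdiv.trans (pow_le_pow_right₀ h1 hk)
      _ = _ := by
          rw [zpow_neg, zpow_natCast]
          field_simp

/-- Polynomial decay gives boundedness of the multipliers from `L¹` to `L^∞`. -/
theorem C0Semigroup.isBoundedMultiplier_of_decay (T : C0Semigroup X)
    (hρ : ∀ μ : ℂ, 0 ≤ μ.re → μ ∈ resolventSet T.generator) {D : ℝ} {N : ℕ} (hD0 : 0 ≤ D)
    (hD : ∀ μ : ℂ, 0 ≤ μ.re → ‖resolvent T.generator μ‖ ≤ D * (1 + ‖μ‖) ^ N)
    (S : X →L[ℂ] X) {n : ℕ} {C : ℝ} (hC : 0 ≤ C)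
    (hdec : ∀ (x : X) (t : ℝ≥0), 1 ≤ t → ‖T.op t (S x)‖ ≤ C * (t : ℝ) ^ (-(n : ℤ)) * ‖x‖)
    {k : ℕ} (hk : k ≤ n) :
    IsBoundedMultiplier 1 ⊤ fun ξ : ℝ =>
      (resolvent T.generator (Complex.I * ξ) ^ (k + 1)).comp S := by
  -- The case k = 0 says that T(s)S is bounded, so the convolution formula is available on every
  -- line Re λ = ε > 0.
  obtain ⟨M₀, hM₀, h₀⟩ := T.exists_kernel_bound S hC hdec (Nat.zero_le n)
  obtain ⟨M, hM, hM'⟩ := T.exists_kernel_bound S hC hdec hk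
  have hc := continuousOn_resolvent_of_growth hρ hD
  have hS : ∀ s : ℝ, 0 ≤ s → ∀ x, ‖T.op s.toNNReal (S x)‖ ≤ M₀ * Real.exp (0 * s) * ‖x‖ := by
    intro s hs x
    simpa using h₀ s hs x
  refine ⟨⟨M, hM⟩, fun f => ?_⟩
  -- The symbol is moved to Re λ = ε, while 𝓕f stays on the real line; all bounds are uniform for 0
  -- ≤ ε ≤ 1.
  set G : ℝ → ℝ → X := fun ε ξ =>
    (resolvent T.generator (ε + Complex.I * ξ) ^ (k + 1)) (S (fourier f ξ)) with hG
  have hG0 : (fun ξ : ℝ => ((resolvent T.generator (Complex.I * ξ) ^ (k + 1)).comp S)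
      (fourier f ξ)) = G 0 := by
    ext ξ
    simp [hG]
  set K : ℝ := (D * (1 + 1) ^ N) ^ (k + 1) * ‖S‖
  have hcont : ∀ ε : ℝ, 0 ≤ ε → Continuous (G ε) := fun ε hε =>
    ((continuous_resolvent_line hc hε).pow _).clm_apply (S.continuous.comp (continuous_fourier f))
  have hbd : ∀ ε : ℝ, 0 ≤ ε → ε ≤ 1 → ∀ ξ,
      ‖G ε ξ‖ ≤ K * (‖fourier f ξ‖ * (1 + |ξ|) ^ (N * (k + 1))) := by
    intro ε h0 h1 ξ
    calc ‖G ε ξ‖ ≤ ((D * (1 + 1) ^ N) ^ (k + 1) * (1 + |ξ|) ^ (N * (k + 1))) *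
          (‖S‖ * ‖fourier f ξ‖) :=
          (ContinuousLinearMap.le_opNorm _ _).trans (mul_le_mul
            (norm_resolvent_pow_le hD0 hD k h0 h1 ξ) (S.le_opNorm _) (norm_nonneg _)
            (by positivity))
      _ = _ := by ring
  have hint := (integrable_fourier_mul_pow f (N * (k + 1))).const_mul K
  refine ⟨?_, ?_⟩
  · rw [hG0]
    exact hint.mono' (hcont 0 le_rfl).aestronglyMeasurable
      (.of_forall (hbd 0 le_rfl zero_le_one))
  · have hm : multiplierOp (fun ξ : ℝ =>
        (resolvent T.generator (Complex.I * ξ) ^ (k + 1)).comp S) f = fourierInv (G 0) := by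
      rw [multiplierOp, hG0]
    rw [hm, eLpNorm_exponent_top]
    have hpt : ∀ t, ‖fourierInv (G 0) t‖ ≤ M * ∫ x, ‖f x‖ := by
      intro t
      have hlim : Tendsto (fun ε : ℝ => fourierInv (G ε) t) (𝓝[>] 0) (𝓝 (fourierInv (G 0) t)) := by
        unfold fourierInv
        refine Tendsto.const_smul ?_ _
        refine tendsto_integral_filter_of_dominated_convergence
          (fun ξ => K * (‖fourier f ξ‖ * (1 + |ξ|) ^ (N * (k + 1)))) ?_ ?_ hint ?_
        · filter_upwards [self_mem_nhdsWithin] with ε hε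
          exact (Continuous.smul (by fun_prop) (hcont ε (le_of_lt hε))).aestronglyMeasurable
        · filter_upwards [Ioc_mem_nhdsGT zero_lt_one] with ε hε
          refine .of_forall fun ξ => ?_
          rw [norm_smul, Complex.norm_exp]
          simpa using hbd ε hε.1.le hε.2 ξ
        · refine .of_forall fun ξ => Tendsto.const_smul ?_ _
          have h1 : Tendsto (fun ε : ℝ => resolvent T.generator (ε + Complex.I * ξ)) (𝓝[>] 0)
              (𝓝 (resolvent T.generator ((0 : ℝ) + Complex.I * ξ))) := by
            refine (hc ((0 : ℝ) + Complex.I * ξ) (by simp)).tendsto.comp ?_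
            refine tendsto_nhdsWithin_iff.2 ⟨?_, ?_⟩
            · have : Continuous fun ε : ℝ => (ε + Complex.I * ξ : ℂ) := by fun_prop
              exact (this.tendsto 0).mono_left nhdsWithin_le_nhds
            · filter_upwards [self_mem_nhdsWithin] with ε hε
              simpa using le_of_lt hε
          exact ((ContinuousLinearMap.apply ℂ X (S (fourier f ξ))).continuous.tendsto _).comp
            (h1.pow (k + 1))
      refine le_of_tendsto hlim.norm ?_
      filter_upwards [self_mem_nhdsWithin] with ε hε
      have hε0 : (0 : ℝ) < ε := hε
      rw [T.fourierInv_resolvent_pow S hS hε0 (fun ξ => hρ _ (by simpa using hε0.le)) k f t]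
      have hf : Integrable fun s => ‖f (t - s)‖ := f.integrable.norm.comp_sub_left t
      calc _ ≤ ∫ s in Ioi (0 : ℝ), M * ‖f (t - s)‖ := by
            refine norm_integral_le_of_norm_le (hf.const_mul M).integrableOn ?_
            filter_upwards [ae_restrict_mem measurableSet_Ioi] with s hs
            have hs0 : 0 ≤ s := le_of_lt hs
            rw [norm_smul, norm_laplaceKernel _ _ hs0, mul_assoc, mul_comm (Real.exp _),
              ← mul_assoc]
            -- Dropping e^{-εs} ≤ 1 makes the estimate independent of ε.
            refine (mul_le_of_le_one_right (by positivity) ?_).trans (hM' s hs0 _)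
            rw [Real.exp_le_one_iff, Complex.ofReal_re]
            have := mul_nonneg hε0.le hs0
            linarith
        _ ≤ ∫ s, M * ‖f (t - s)‖ :=
            setIntegral_le_integral (hf.const_mul M) (.of_forall fun s => by positivity)
        _ = _ := by rw [integral_const_mul, integral_sub_left_eq_self (fun s => ‖f s‖)]
    refine (eLpNormEssSup_le_of_ae_bound (.of_forall hpt)).trans_eq ?_
    rw [eLpNorm_one_eq_lintegral_enorm, ENNReal.ofReal_mul hM,
      ofReal_integral_norm_eq_lintegral_enorm f.integrable]
    congr 1
    rw [ENNReal.ofReal]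
    congr 1
    exact Real.toNNReal_of_nonneg hM

end Decay

/-! ### Contour shift, and the convolution formula on the imaginary axis for compactly supported
inputs. -/

section Contour

variable {X : Type*} [NormedAddCommGroup X] [NormedSpace ℂ X]

/-- Shifting a vertical contour of integration. -/
theorem integral_vertical_eq [CompleteSpace X] {G : ℂ → X} {a C : ℝ} (ha : 0 ≤ a)
    (hc : ContinuousOn G {μ | 0 ≤ μ.re}) (hd : DifferentiableOn ℂ G {μ | 0 < μ.re})
    (hG : ∀ r, 0 ≤ r → r ≤ a → ∀ ξ : ℝ, ‖G (r + Complex.I * ξ)‖ ≤ C * (1 + ξ ^ 2)⁻¹) :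
    ∫ ξ : ℝ, G (Complex.I * ξ) = ∫ ξ : ℝ, G (a + Complex.I * ξ) := by
  have hint : ∀ r : ℝ, 0 ≤ r → r ≤ a → Integrable fun ξ : ℝ => G (r + Complex.I * ξ) := by
    intro r h0 h1
    refine (integrable_inv_one_add_sq.const_mul C).mono' ?_ (.of_forall (hG r h0 h1))
    exact (hc.comp_continuous (by fun_prop) (by simp [h0])).aestronglyMeasurable
  have hvert : ∀ r : ℝ, 0 ≤ r → r ≤ a →
      Tendsto (fun N : ℝ => ∫ y in (-N)..N, G (r + Complex.I * y)) atTop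
        (𝓝 (∫ ξ : ℝ, G (r + Complex.I * ξ))) := fun r h0 h1 =>
    intervalIntegral_tendsto_integral (hint r h0 h1) tendsto_neg_atTop_atBot tendsto_id
  have hdecay : Tendsto (fun N : ℝ => C * (1 + N ^ 2)⁻¹ * |a - 0|) atTop (𝓝 0) := by
    have : Tendsto (fun N : ℝ => (1 + N ^ 2)⁻¹) atTop (𝓝 0) :=
      tendsto_inv_atTop_zero.comp (tendsto_atTop_add_const_left _ _ (tendsto_pow_atTop two_ne_zero))
    simpa using (this.const_mul C).mul_const |a - 0|
  -- σ = ±1 treats the top and bottom edges of the rectangle together.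
  have hhor : ∀ σ : ℝ, σ ^ 2 = 1 →
      Tendsto (fun N : ℝ => ∫ x in (0 : ℝ)..a, G (x + Complex.I * (σ * N : ℝ))) atTop (𝓝 0) := by
    intro σ hσ
    refine squeeze_zero_norm (fun N => ?_) hdecay
    refine intervalIntegral.norm_integral_le_of_norm_le_const fun x hx => ?_
    rw [uIoc_of_le ha] at hx
    refine (hG x hx.1.le hx.2 _).trans_eq ?_
    rw [mul_pow, hσ, one_mul]
  have hrect : ∀ N : ℝ, (∫ x in (0 : ℝ)..a, G (x + Complex.I * (-1 * N : ℝ))) -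
      (∫ x in (0 : ℝ)..a, G (x + Complex.I * (1 * N : ℝ))) +
      Complex.I • (∫ y in (-N)..N, G (a + Complex.I * y)) -
      Complex.I • (∫ y in (-N)..N, G ((0 : ℝ) + Complex.I * y)) = 0 := by
    intro N
    have h := Complex.integral_boundary_rect_eq_zero_of_continuousOn_of_differentiableOn G
      ⟨0, -N⟩ ⟨a, N⟩ (hc.mono ?_) (hd.mono ?_)
    · simpa only [mul_comm Complex.I, neg_one_mul, one_mul] using h
    · intro μ hμ
      have := hμ.1
      simp only [mem_preimage, uIcc_of_le ha] at this
      exact this.1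
    · intro μ hμ
      have := hμ.1
      simp only [mem_preimage, min_eq_left ha] at this
      exact this.1
  have hlim := (((hhor (-1) (by norm_num)).sub (hhor 1 (by norm_num))).add
    ((hvert a ha le_rfl).const_smul Complex.I)).sub ((hvert 0 le_rfl ha).const_smul Complex.I)
  have h0 := tendsto_nhds_unique (hlim.congr hrect) tendsto_const_nhds
  rw [sub_zero, zero_add, ← smul_sub, smul_eq_zero, or_iff_right Complex.I_ne_zero,
    sub_eq_zero] at h0
  rw [h0]
  simp

/-- The two-sided Laplace transform `μ ↦ ∫ e^{-μ x} f(x) dx`. -/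
noncomputable def laplaceTransform (f : ℝ → X) (μ : ℂ) : X :=
  ∫ x : ℝ, Complex.exp (-(μ * x)) • f x

variable {f : ℝ → X}

theorem hasCompactSupport_of_unit {E : Type*} [NormedAddCommGroup E] {f : ℝ → E}
    (hf0 : ∀ x ∉ Icc (0 : ℝ) 1, f x = 0) : HasCompactSupport f :=
  HasCompactSupport.intro isCompact_Icc hf0

theorem integrable_exp_smul (hf : Continuous f) (hf0 : ∀ x ∉ Icc (0 : ℝ) 1, f x = 0) (μ : ℂ) :
    Integrable fun x : ℝ => Complex.exp (-(μ * x)) • f x :=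
  Continuous.integrable_of_hasCompactSupport (by fun_prop)
    (hasCompactSupport_of_unit hf0).smul_left

theorem differentiable_laplaceTransform (hf : Continuous f)
    (hf0 : ∀ x ∉ Icc (0 : ℝ) 1, f x = 0) : Differentiable ℂ (laplaceTransform f) := by
  intro μ₀
  have hfi : Integrable f := hf.integrable_of_hasCompactSupport (hasCompactSupport_of_unit hf0)
  refine (hasDerivAt_integral_of_dominated_loc_of_deriv_le
    (F := fun (μ : ℂ) (x : ℝ) => Complex.exp (-(μ * x)) • f x)
    (F' := fun (μ : ℂ) (x : ℝ) => (Complex.exp (-(μ * x)) * -(x : ℂ)) • f x)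
    (bound := fun x => Real.exp (‖μ₀‖ + 1) * ‖f x‖) (Metric.ball_mem_nhds μ₀ one_pos)
    (.of_forall fun μ => (integrable_exp_smul hf hf0 μ).aestronglyMeasurable)
    (integrable_exp_smul hf hf0 μ₀)
    (Continuous.smul (by fun_prop) hf).aestronglyMeasurable
    (.of_forall fun x μ hμ => ?_) (hfi.norm.const_mul _)
    (.of_forall fun x μ hμ => ?_)).2.differentiableAt
  · rcases em (x ∈ Icc (0 : ℝ) 1) with hx | hx
    · rw [norm_smul, norm_mul, Complex.norm_exp, norm_neg, Complex.norm_real,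
        Real.norm_of_nonneg hx.1]
      gcongr
      refine (mul_le_of_le_one_right (Real.exp_pos _).le hx.2).trans ?_
      gcongr
      have h1 : ‖μ‖ ≤ ‖μ₀‖ + 1 := by
        have := norm_le_norm_add_norm_sub' μ μ₀
        rw [Metric.mem_ball, dist_eq_norm] at hμ
        linarith
      calc (-(μ * x)).re ≤ ‖-(μ * (x : ℂ))‖ := Complex.re_le_norm _
        _ = ‖μ‖ * x := by
          rw [norm_neg, norm_mul, Complex.norm_real, Real.norm_of_nonneg hx.1]
        _ ≤ ‖μ‖ := mul_le_of_le_one_right (norm_nonneg _) hx.2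
        _ ≤ _ := h1
    · simp [hf0 x hx]
  · refine HasDerivAt.smul_const ?_ _
    refine HasDerivAt.cexp ?_
    have h0 := ((hasDerivAt_id μ).mul_const (x : ℂ)).neg
    rw [one_mul] at h0
    exact h0

theorem norm_laplaceTransform_le (hf : Continuous f) (hf0 : ∀ x ∉ Icc (0 : ℝ) 1, f x = 0) {μ : ℂ}
    (hμ : 0 ≤ μ.re) : ‖laplaceTransform f μ‖ ≤ ∫ x, ‖f x‖ := by
  have hfi : Integrable f := hf.integrable_of_hasCompactSupport (hasCompactSupport_of_unit hf0)
  refine norm_integral_le_of_norm_le hfi.norm (.of_forall fun x => ?_)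
  rcases em (x ∈ Icc (0 : ℝ) 1) with hx | hx
  · rw [norm_smul, Complex.norm_exp]
    refine mul_le_of_le_one_left (norm_nonneg _) ?_
    rw [Real.exp_le_one_iff]
    simpa using mul_nonneg hμ hx.1
  · simp [hf0 x hx]

theorem deriv_eq_zero_of_unit (hf0 : ∀ x ∉ Icc (0 : ℝ) 1, f x = 0) :
    ∀ x ∉ Icc (0 : ℝ) 1, deriv f x = 0 := by
  intro x hx
  have : f =ᶠ[𝓝 x] fun _ => 0 := by
    filter_upwards [isClosed_Icc.isOpen_compl.mem_nhds hx] with y hy using hf0 y hy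
  rw [this.deriv_eq]
  simp

theorem laplaceTransform_deriv [CompleteSpace X] (hf : ContDiff ℝ 1 f)
    (hf0 : ∀ x ∉ Icc (0 : ℝ) 1, f x = 0) (μ : ℂ) :
    laplaceTransform (deriv f) μ = μ • laplaceTransform f μ := by
  have hd : Continuous (deriv f) := hf.continuous_deriv le_rfl
  have i1 := integrable_exp_smul hd (deriv_eq_zero_of_unit hf0) μ
  have i2 := integrable_exp_smul hf.continuous hf0 μ
  have i3 : Integrable fun x : ℝ => μ • Complex.exp (-(μ * x)) • f x := i2.smul μ
  have h := integral_eq_zero_of_hasDerivAt_of_integrable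
    (f := fun x : ℝ => Complex.exp (-(μ * x)) • f x)
    (f' := fun x : ℝ => Complex.exp (-(μ * x)) • deriv f x - μ • Complex.exp (-(μ * x)) • f x)
    (fun x => by
      have h1 : HasDerivAt (fun x : ℝ => -(μ * (x : ℂ))) (-μ) x := by
        have h0 := ((hasDerivAt_id x).ofReal_comp.const_mul μ).neg
        simp only [Complex.ofReal_one, mul_one] at h0
        exact h0
      have h2 := h1.cexp.smul ((hf.differentiable one_ne_zero x).hasDerivAt)
      refine h2.congr_deriv ?_
      module)
    (i1.sub i3) i2
  rw [integral_sub i1 i3, integral_smul, sub_eq_zero] at h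
  exact h

/-- Integrate by parts m times: each derivative is again supported in [0, 1], where |e^{-μx}| ≤ 1
for Re μ ≥ 0. -/
theorem norm_pow_mul_laplaceTransform_le [CompleteSpace X] (m : ℕ) (hf : ContDiff ℝ m f)
    (hf0 : ∀ x ∉ Icc (0 : ℝ) 1, f x = 0) :
    ∃ C, ∀ μ : ℂ, 0 ≤ μ.re → ‖μ‖ ^ m * ‖laplaceTransform f μ‖ ≤ C := by
  induction m generalizing f with
  | zero =>
    exact ⟨_, fun μ hμ => by simpa using norm_laplaceTransform_le hf.continuous hf0 hμ⟩
  | succ m ih =>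
    have h1 : ContDiff ℝ 1 f := hf.of_le (by exact_mod_cast Nat.le_add_left 1 m)
    have h2 : ContDiff ℝ m (deriv f) := (contDiff_succ_iff_deriv.1 (by exact_mod_cast hf)).2.2
    obtain ⟨C, hC⟩ := ih h2 (deriv_eq_zero_of_unit hf0)
    refine ⟨C, fun μ hμ => ?_⟩
    have := hC μ hμ
    rwa [laplaceTransform_deriv h1 hf0, norm_smul, ← mul_assoc, ← pow_succ] at this

theorem laplaceTransform_decay [CompleteSpace X] (m : ℕ) (hf : ContDiff ℝ m f)
    (hf0 : ∀ x ∉ Icc (0 : ℝ) 1, f x = 0) :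
    ∃ C, 0 ≤ C ∧ ∀ μ : ℂ, 0 ≤ μ.re → ‖laplaceTransform f μ‖ * (1 + |μ.im|) ^ m ≤ C := by
  obtain ⟨C, hC⟩ := norm_pow_mul_laplaceTransform_le m hf hf0
  have hN : ∀ μ : ℂ, 0 ≤ μ.re →
      ‖laplaceTransform f μ‖ * (1 + |μ.im|) ^ m ≤ 2 ^ m * ((∫ x, ‖f x‖) + C) := by
    intro μ hμ
    calc _ ≤ ‖laplaceTransform f μ‖ * (2 ^ m * (1 + ‖μ‖ ^ m)) := by
          gcongr
          rcases le_total |μ.im| 1 with h | h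
          · calc (1 + |μ.im|) ^ m ≤ 2 ^ m := by gcongr; linarith
              _ ≤ _ := le_mul_of_one_le_right (by positivity) (by simp)
          · calc (1 + |μ.im|) ^ m ≤ (2 * ‖μ‖) ^ m := by
                  gcongr
                  linarith [Complex.abs_im_le_norm μ]
              _ = 2 ^ m * ‖μ‖ ^ m := mul_pow _ _ _
              _ ≤ _ := by gcongr; linarith
      _ = 2 ^ m * (‖laplaceTransform f μ‖ + ‖μ‖ ^ m * ‖laplaceTransform f μ‖) := by ring
      _ ≤ _ := by
          gcongr
          · exact norm_laplaceTransform_le hf.continuous hf0 hμ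
          · exact hC μ hμ
  exact ⟨_, le_trans (by positivity) (hN 0 le_rfl), hN⟩

theorem fourier_exp_smul (f : ℝ → X) (a ξ : ℝ) :
    fourier (fun x : ℝ => Complex.exp (-(a * x)) • f x) ξ =
      laplaceTransform f (a + Complex.I * ξ) := by
  unfold fourier laplaceTransform
  congr 1
  ext x
  rw [smul_smul, ← Complex.exp_add]
  ring_nf

theorem fourier_eq_laplaceTransform (f : ℝ → X) (ξ : ℝ) :
    fourier f ξ = laplaceTransform f (Complex.I * ξ) := by
  unfold fourier laplaceTransform
  congr 1
  ext x
  ring_nf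

/-- For smooth functions supported in `[0, 1]`, the multiplier with symbol `R(iξ)^{k+1} S` is a
convolution, without any growth restriction on the semigroup. -/
theorem C0Semigroup.fourierInv_resolvent_pow_imaginary [CompleteSpace X] (T : C0Semigroup X)
    (hρ : ∀ μ : ℂ, 0 ≤ μ.re → μ ∈ resolventSet T.generator) {D : ℝ} {N : ℕ} (hD0 : 0 ≤ D)
    (hD : ∀ μ : ℂ, 0 ≤ μ.re → ‖resolvent T.generator μ‖ ≤ D * (1 + ‖μ‖) ^ N)
    (S : X →L[ℂ] X) (k : ℕ) (hf : ContDiff ℝ (⊤ : ℕ∞) f)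
    (hf0 : ∀ x ∉ Icc (0 : ℝ) 1, f x = 0) (t : ℝ) :
    fourierInv (fun ξ : ℝ =>
      (resolvent T.generator (Complex.I * ξ) ^ (k + 1)) (S (fourier f ξ))) t =
      ∫ s in Ioi (0 : ℝ), laplaceKernel k 0 s • T.op s.toNNReal (S (f (t - s))) := by
  obtain ⟨M, ω, hM, hω, hT⟩ := T.exists_exp_bound
  have hS : ∀ s : ℝ, 0 ≤ s → ∀ x, ‖T.op s.toNNReal (S x)‖ ≤
      (M * ‖S‖) * Real.exp (ω * s) * ‖x‖ := by
    intro s hs x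
    calc _ ≤ ‖T.op s.toNNReal‖ * (‖S‖ * ‖x‖) := ((T.op _).le_opNorm _).trans
          (mul_le_mul_of_nonneg_left (S.le_opNorm x) (norm_nonneg _))
      _ ≤ M * Real.exp (ω * s.toNNReal) * (‖S‖ * ‖x‖) := by gcongr; exact hT _
      _ = _ := by rw [Real.coe_toNNReal _ hs]; ring
  -- Any abscissa beyond the exponential growth bound ω would do.
  set a := ω + 1
  have ha : 0 ≤ a := by positivity
  have hωa : ω < a := lt_add_one ω
  have hc := continuousOn_resolvent_of_growth hρ hD
  have hLd := differentiable_laplaceTransform hf.continuous hf0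
  -- N(k + 1) powers absorb the growth of R(λ)^{k+1}; the last two give (1 + ξ²)⁻¹ uniformly in the
  -- strip.
  set m := N * (k + 1) + 2
  obtain ⟨C, hC0, hC⟩ := laplaceTransform_decay m
    (hf.of_le (by exact_mod_cast le_top)) hf0
  set G : ℂ → X := fun μ => Complex.exp (μ * t) •
    (resolvent T.generator μ ^ (k + 1)) (S (laplaceTransform f μ)) with hG
  have hGc : ContinuousOn G {μ | 0 ≤ μ.re} :=
    ContinuousOn.smul (by fun_prop)
      ((hc.pow _).clm_apply (S.continuous.comp hLd.continuous).continuousOn)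
  have hGd : DifferentiableOn ℂ G {μ | 0 < μ.re} := by
    intro μ hμ
    have hR : DifferentiableAt ℂ (resolvent T.generator) μ :=
      (hasDerivAt_resolvent (s := {μ | 0 ≤ μ.re}) hρ hc
        (mem_of_superset ((isOpen_lt continuous_const Complex.continuous_re).mem_nhds hμ)
          fun ν (hν : 0 < ν.re) => show 0 ≤ ν.re from hν.le)).differentiableAt
    refine DifferentiableAt.differentiableWithinAt ?_
    exact DifferentiableAt.smul (by fun_prop)
      ((hR.pow _).clm_apply (S.differentiableAt.comp μ (hLd μ)))
  have hGb : ∀ r, 0 ≤ r → r ≤ a → ∀ ξ : ℝ, ‖G (r + Complex.I * ξ)‖ ≤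
      (Real.exp (a * |t|) * (D * (1 + a) ^ N) ^ (k + 1) * ‖S‖ * C) * (1 + ξ ^ 2)⁻¹ := by
    intro r h0 h1 ξ
    have hL := hC (r + Complex.I * ξ) (by simpa using h0)
    simp only [Complex.add_im, Complex.ofReal_im, Complex.mul_im, Complex.I_re, zero_mul,
      Complex.I_im, Complex.ofReal_re, one_mul, zero_add] at hL
    have hexp : ‖Complex.exp ((r + Complex.I * ξ) * t)‖ ≤ Real.exp (a * |t|) := by
      rw [Complex.norm_exp]
      gcongr
      simp only [Complex.mul_re, Complex.add_re, Complex.ofReal_re, Complex.I_re, zero_mul,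
        Complex.I_im, Complex.ofReal_im, mul_zero, sub_zero, add_zero]
      calc r * t ≤ r * |t| := by gcongr; exact le_abs_self t
        _ ≤ _ := by gcongr
    have h2 : 1 + ξ ^ 2 ≤ (1 + |ξ|) ^ 2 := by nlinarith [abs_nonneg ξ, sq_abs ξ]
    rw [← div_eq_mul_inv, le_div_iff₀ (by positivity), hG, norm_smul]
    calc _ ≤ Real.exp (a * |t|) * (((D * (1 + a) ^ N) ^ (k + 1) * (1 + |ξ|) ^ (N * (k + 1))) *
          (‖S‖ * ‖laplaceTransform f (r + Complex.I * ξ)‖)) * (1 + |ξ|) ^ 2 := by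
          gcongr
          exact (ContinuousLinearMap.le_opNorm _ _).trans (mul_le_mul
            (norm_resolvent_pow_le hD0 hD k h0 h1 ξ) (S.le_opNorm _) (norm_nonneg _)
            (by positivity))
      _ = (Real.exp (a * |t|) * (D * (1 + a) ^ N) ^ (k + 1) * ‖S‖) *
          (‖laplaceTransform f (r + Complex.I * ξ)‖ * (1 + |ξ|) ^ m) := by
          simp only [m, pow_add]; ring
      _ ≤ _ := by gcongr
  have hshift := integral_vertical_eq ha hGc hGd hGb
  have hfa : ContDiff ℝ (⊤ : ℕ∞) fun x : ℝ => Complex.exp (-(a * x)) • f x := by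
    refine ContDiff.smul ?_ hf
    exact ((contDiff_const.mul Complex.ofRealCLM.contDiff).neg).cexp
  -- On Re λ = a the transform of f is the Fourier transform of e^{-ax} f, to which the convolution
  -- formula for Schwartz functions applies.
  set g : 𝓢(ℝ, X) := HasCompactSupport.toSchwartzMap
    (f := fun x : ℝ => Complex.exp (-(a * x)) • f x)
    (hasCompactSupport_of_unit hf0).smul_left hfa with hg
  have hgc : ∀ x, g x = Complex.exp (-(a * x)) • f x := fun x => rfl
  have hconv := T.fourierInv_resolvent_pow S hS hωa (fun ξ => hρ _ (by simpa using ha)) k g t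
  have hgf : ∀ ξ : ℝ, fourier g ξ = laplaceTransform f (a + Complex.I * ξ) :=
    fourier_exp_smul f a
  simp only [hgf, hgc] at hconv
  simp only [fourier_eq_laplaceTransform]
  have hL : fourierInv (fun ξ : ℝ => (resolvent T.generator (Complex.I * ξ) ^ (k + 1))
      (S (laplaceTransform f (Complex.I * ξ)))) t = (2 * Real.pi)⁻¹ • ∫ ξ : ℝ, G (Complex.I * ξ) := by
    unfold fourierInv
    congr 2
    ext ξ
    simp only [hG]
    ring_nf
  have hRt : (2 * Real.pi)⁻¹ • ∫ ξ : ℝ, G (a + Complex.I * ξ) = Complex.exp (a * t) •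
      fourierInv (fun ξ : ℝ => (resolvent T.generator (a + Complex.I * ξ) ^ (k + 1))
      (S (laplaceTransform f (a + Complex.I * ξ)))) t := by
    unfold fourierInv
    rw [smul_comm, ← integral_smul (Complex.exp (a * t))]
    congr 2
    ext ξ
    rw [smul_smul, ← Complex.exp_add]
    simp only [hG]
    ring_nf
  rw [hL, hshift, hRt, hconv, ← integral_smul]
  refine integral_congr_ae (.of_forall fun s => ?_)
  simp only [map_smul, smul_smul]
  congr 1
  -- The weights cancel: e^{at} · e^{-as} · e^{-a(t-s)} = 1.
  unfold laplaceKernel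
  rw [mul_left_comm, mul_assoc, ← Complex.exp_add, ← Complex.exp_add]
  congr 2
  push_cast
  ring

end Contour

/-! ### From a multiplier bound to polynomial decay. -/

section Necessity

open scoped Nat Convolution

/-- The interval has measure one, so a constant has the same L^q norm for every q. -/
theorem eLpNorm_ge_of_unit_interval {E : Type*} [NormedAddCommGroup E] {h : ℝ → E} {q : ℝ≥0∞}
    (hq : 1 ≤ q) {t L : ℝ} (hL0 : 0 ≤ L)
    (hL : ∀ s ∈ Icc (t - 1) t, L ≤ ‖h s‖) : ENNReal.ofReal L ≤ eLpNorm h q volume := by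
  have hv : (volume.restrict (Icc (t - 1) t)) univ = 1 := by simp
  have hne : volume.restrict (Icc (t - 1) t) ≠ 0 := by
    intro h0
    simp [h0] at hv
  calc ENNReal.ofReal L = eLpNorm (fun _ : ℝ => L) q (volume.restrict (Icc (t - 1) t)) := by
        rw [eLpNorm_const _ (by positivity) hne, hv, ENNReal.one_rpow, mul_one,
          Real.enorm_eq_ofReal hL0]
    _ ≤ eLpNorm h q (volume.restrict (Icc (t - 1) t)) := by
        refine eLpNorm_mono_ae ?_
        filter_upwards [ae_restrict_mem measurableSet_Icc] with s hs
        rw [Real.norm_of_nonneg hL0]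
        exact hL s hs
    _ ≤ _ := eLpNorm_mono_measure _ Measure.restrict_le_self

theorem eLpNorm_le_of_unit_support {E : Type*} [NormedAddCommGroup E] {f : ℝ → E} (p : ℝ≥0∞)
    {K : ℝ}
    (hf0 : ∀ x ∉ Icc (0 : ℝ) 1, f x = 0) (hK : ∀ x ∈ Icc (0 : ℝ) 1, ‖f x‖ ≤ K) :
    eLpNorm f p volume ≤ ENNReal.ofReal K := by
  have e : f = (Icc (0 : ℝ) 1).indicator f := by
    ext x
    by_cases hx : x ∈ Icc (0 : ℝ) 1
    · rw [indicator_of_mem hx]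
    · rw [indicator_of_notMem hx, hf0 x hx]
  rw [e, eLpNorm_indicator_eq_eLpNorm_restrict measurableSet_Icc]
  refine (eLpNorm_le_of_ae_bound (C := K) ?_).trans_eq ?_
  · filter_upwards [ae_restrict_mem measurableSet_Icc] with x hx using hK x hx
  · simp

variable {X : Type*} [NormedAddCommGroup X] [NormedSpace ℂ X] [CompleteSpace X]

/-- Vectors with a smooth orbit are dense. -/
theorem C0Semigroup.exists_smooth_orbit (T : C0Semigroup X) (z₀ : X) {ε : ℝ} (hε : 0 < ε) :
    ∃ z : X, ‖z - z₀‖ < ε ∧ ∃ w : ℝ → X, ContDiff ℝ (⊤ : ℕ∞) w ∧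
      ∀ r, 0 ≤ r → w r = T.op r.toNNReal z := by
  set u : ℝ → X := fun s => T.op s.toNNReal z₀
  have hu : Continuous u := T.continuous_op_comp continuous_id continuous_const
  have hu0 : u 0 = z₀ := by simp [u, T.op_zero]
  set ψ : ℕ → ContDiffBump (0 : ℝ) := fun i =>
    { rIn := 1 / ((i : ℝ) + 1) / 2
      rOut := 1 / ((i : ℝ) + 1)
      rIn_pos := by positivity
      rIn_lt_rOut := half_lt_self (by positivity) } with hψ
  have hr : Tendsto (fun i => (ψ i).rOut) atTop (𝓝 0) := tendsto_one_div_add_atTop_nhds_zero_nat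
  -- The mollified orbit is evaluated at `rOut` rather than at 0: on the support of the bump the
  -- time `rOut - v` is then nonnegative, so applying T(r) is exactly a translation by r.
  have hlim : Tendsto (fun i => ((ψ i).normed volume ⋆[ContinuousLinearMap.lsmul ℝ ℝ, volume] u)
      ((ψ i).rOut)) atTop (𝓝 z₀) := by
    refine ContDiffBump.convolution_tendsto_right (k := fun i => (ψ i).rOut) (x₀ := 0) hr
      (.of_forall fun _ => hu.aestronglyMeasurable) ?_ hr
    rw [← hu0]
    exact (hu.tendsto 0).comp tendsto_snd
  obtain ⟨i, hi⟩ := ((tendsto_iff_norm_sub_tendsto_zero.1 hlim).eventually (gt_mem_nhds hε)).exists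
  refine ⟨_, hi, fun r => ((ψ i).normed volume ⋆[ContinuousLinearMap.lsmul ℝ ℝ, volume] u)
    (r + (ψ i).rOut), ?_, fun r hr0 => ?_⟩
  · have := HasCompactSupport.contDiff_convolution_left (ContinuousLinearMap.lsmul ℝ ℝ)
      ((ψ i).hasCompactSupport_normed (μ := volume)) ((ψ i).contDiff_normed (μ := volume) (n := (⊤ : ℕ∞)))
      (hu.locallyIntegrable (μ := volume))
    exact this.comp (contDiff_id.add contDiff_const)
  · unfold convolution
    have hi : Integrable fun t => (ContinuousLinearMap.lsmul ℝ ℝ) ((ψ i).normed volume t)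
        (u ((ψ i).rOut - t)) :=
      Continuous.integrable_of_hasCompactSupport
        (((ψ i).continuous_normed (μ := volume)).smul (hu.comp (by fun_prop)))
        (((ψ i).hasCompactSupport_normed (μ := volume)).smul_right)
    rw [← ContinuousLinearMap.integral_comp_comm _ hi]
    refine integral_congr_ae (.of_forall fun v => ?_)
    simp only [ContinuousLinearMap.lsmul_apply]
    by_cases hv : v ∈ Function.support ((ψ i).normed volume)
    · rw [(ψ i).support_normed_eq, Metric.mem_ball, dist_zero_right, Real.norm_eq_abs] at hv
      have h1 : 0 ≤ (ψ i).rOut - v := by linarith [le_abs_self v]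
      rw [ContinuousLinearMap.map_smul_of_tower]
      simp only [u]
      rw [← T.op_add_apply, ← Real.toNNReal_add hr0 h1]
      ring_nf
    · rw [Function.notMem_support] at hv
      simp [hv]

/-- A smooth cut-off function supported in `[0, 1]`. -/
noncomputable def unitBump : ContDiffBump (1 / 2 : ℝ) where
  rIn := 1 / 4
  rOut := 1 / 2
  rIn_pos := by norm_num
  rIn_lt_rOut := by norm_num

theorem unitBump_eq_zero {x : ℝ} (hx : x ∉ Ioo (0 : ℝ) 1) : unitBump x = 0 := by
  rw [← Function.notMem_support, unitBump.support_eq, unitBump, Real.ball_eq_Ioo]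
  norm_num
  simpa using hx

/-- Convolution of a truncated orbit with `s ↦ s^n / n! · T(s)` reproduces the orbit. -/
theorem C0Semigroup.norm_integral_orbit_ge (T : C0Semigroup X) (S : X →L[ℂ] X)
    (hST : ∀ (t : ℝ≥0) (x : X), S (T.op t x) = T.op t (S x)) (n : ℕ) {z : X} {w : ℝ → X}
    (hw : ∀ r, 0 ≤ r → w r = T.op r.toNNReal z) {t : ℝ} (ht : 1 ≤ t) :
    (t - 1) ^ n / n ! * (∫ x, unitBump x) * ‖T.op t.toNNReal (S z)‖ ≤
      ‖∫ s in Ioi (0 : ℝ), laplaceKernel n 0 s •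
        T.op s.toNNReal (S (unitBump (t - s) • w (t - s)))‖ := by
  -- S commutes with the semigroup, so T(s) S T(t-s) z = T(t)Sz does not depend on s and leaves the
  -- integral.
  have e : ∀ s ∈ Ioi (0 : ℝ), laplaceKernel n 0 s •
      T.op s.toNNReal (S (unitBump (t - s) • w (t - s))) =
      (s ^ n / n ! * unitBump (t - s)) • T.op t.toNNReal (S z) := by
    intro s hs
    have hs0 : 0 ≤ s := le_of_lt hs
    by_cases hts : t - s ∈ Ioo (0 : ℝ) 1
    · rw [hw _ hts.1.le, ContinuousLinearMap.map_smul_of_tower,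
        ContinuousLinearMap.map_smul_of_tower, hST, ← T.op_add_apply,
        ← Real.toNNReal_add hs0 hts.1.le, mul_smul, laplaceKernel, zero_mul, neg_zero,
        Complex.exp_zero, mul_one, Complex.coe_smul]
      ring_nf
    · simp [unitBump_eq_zero hts]
  have hbi : Integrable fun s => unitBump (t - s) :=
    (unitBump.continuous.integrable_of_hasCompactSupport unitBump.hasCompactSupport).comp_sub_left t
  rw [setIntegral_congr_fun measurableSet_Ioi e, integral_smul_const, norm_smul]
  gcongr
  refine le_trans ?_ (Real.le_norm_self _)
  have h1 : ∫ x, unitBump x = ∫ s in Ioi (0 : ℝ), unitBump (t - s) := by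
    rw [← integral_sub_left_eq_self (fun x => unitBump x) volume t,
      setIntegral_eq_integral_of_forall_compl_eq_zero]
    intro s hs
    refine unitBump_eq_zero fun h => hs ?_
    have := h.2
    simp only [mem_Ioi]
    linarith
  rw [h1, ← integral_const_mul]
  refine setIntegral_mono (hbi.const_mul _).integrableOn ?_ fun s => ?_
  · refine (Continuous.integrable_of_hasCompactSupport ?_ ?_).integrableOn
    · exact Continuous.mul (by fun_prop) (unitBump.continuous.comp (by fun_prop))
    · refine HasCompactSupport.mul_left ?_
      exact unitBump.hasCompactSupport.comp_homeomorph (Homeomorph.subLeft t)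
  · by_cases hts : t - s ∈ Ioo (0 : ℝ) 1
    · have h2 : t - 1 ≤ s := by linarith [hts.2]
      have h3 : 0 ≤ unitBump (t - s) := unitBump.nonneg
      have h4 : 0 ≤ t - 1 := by linarith
      show (t - 1) ^ n / n ! * unitBump (t - s) ≤ s ^ n / n ! * unitBump (t - s)
      gcongr
    · simp [unitBump_eq_zero hts]

/-- Boundedness of the multiplier with symbol `R(iξ)^{n+1} S` gives decay of rate `t^{-n}`. -/
theorem C0Semigroup.decay_of_isBoundedMultiplier (T : C0Semigroup X)
    (hρ : ∀ μ : ℂ, 0 ≤ μ.re → μ ∈ resolventSet T.generator) {D : ℝ} {N : ℕ} (hD0 : 0 ≤ D)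
    (hD : ∀ μ : ℂ, 0 ≤ μ.re → ‖resolvent T.generator μ‖ ≤ D * (1 + ‖μ‖) ^ N)
    (S : X →L[ℂ] X) (hST : ∀ (t : ℝ≥0) (x : X), S (T.op t x) = T.op t (S x)) (n : ℕ)
    {p q : ℝ≥0∞} (hq : 1 ≤ q)
    (hm : IsBoundedMultiplier p q fun ξ : ℝ =>
      (resolvent T.generator (Complex.I * ξ) ^ (n + 1)).comp S) :
    ∃ C, 0 ≤ C ∧ ∀ (x : X) (t : ℝ≥0), 1 ≤ t →
      ‖T.op t (S x)‖ ≤ C * (t : ℝ) ^ (-(n : ℤ)) * ‖x‖ := by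
  obtain ⟨M, ω, hM, hω, hT⟩ := T.exists_exp_bound
  obtain ⟨B, hB⟩ := hm
  have hM0 : 0 < M := by linarith
  set c : ℝ := ∫ x, unitBump x
  have hc : 0 < c := unitBump.integral_pos
  set K : ℝ := M * Real.exp ω
  have hK : 0 < K := by positivity
  have hTle : ∀ b s : ℝ, 0 ≤ s → s ≤ b → ∀ x, ‖T.op s.toNNReal x‖ ≤ M * Real.exp (ω * b) * ‖x‖ := by
    intro b s hs hs1 x
    refine ((T.op _).le_opNorm x).trans ?_
    gcongr
    refine (hT _).trans ?_
    rw [Real.coe_toNNReal _ hs]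
    gcongr
  have hTK : ∀ s : ℝ, 0 ≤ s → s ≤ 1 → ∀ x, ‖T.op s.toNNReal x‖ ≤ K * ‖x‖ := by
    intro s hs hs1 x
    simpa using hTle 1 s hs hs1 x
  -- Found by solving L ≤ B K ‖z‖ for t^n ‖T(t)Sz‖, with L the lower bound introduced below.
  set C₁ : ℝ := 3 ^ n * n ! / c * K * (B * K)
  have hsmooth : ∀ (z : X) (w : ℝ → X), ContDiff ℝ (⊤ : ℕ∞) w →
      (∀ r, 0 ≤ r → w r = T.op r.toNNReal z) → ∀ t : ℝ, 3 ≤ t →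
      t ^ n * ‖T.op t.toNNReal (S z)‖ ≤ C₁ * ‖z‖ := by
    intro z w hw hwz t ht
    set f : ℝ → X := fun x => unitBump x • w x with hf
    have hfd : ContDiff ℝ (⊤ : ℕ∞) f := unitBump.contDiff.smul hw
    have hf0 : ∀ x ∉ Icc (0 : ℝ) 1, f x = 0 := by
      intro x hx
      simp only [hf]
      rw [unitBump_eq_zero (fun h => hx (Ioo_subset_Icc_self h)), zero_smul]
    have hfK : ∀ x ∈ Icc (0 : ℝ) 1, ‖f x‖ ≤ K * ‖z‖ := by
      intro x hx
      simp only [hf]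
      rw [norm_smul, Real.norm_of_nonneg unitBump.nonneg, hwz x hx.1]
      exact (mul_le_of_le_one_left (norm_nonneg _) unitBump.le_one).trans (hTK x hx.1 hx.2 z)
    set g : 𝓢(ℝ, X) := HasCompactSupport.toSchwartzMap (hasCompactSupport_of_unit hf0) hfd
    have hgf : (g : ℝ → X) = f := rfl
    have h2 := (hB g).2
    rw [hgf] at h2
    set h := multiplierOp (fun ξ : ℝ => (resolvent T.generator (Complex.I * ξ) ^ (n + 1)).comp S) g
    have hh : ∀ s, h s = ∫ r in Ioi (0 : ℝ), laplaceKernel n 0 r •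
        T.op r.toNNReal (S (f (s - r))) := fun s =>
      T.fourierInv_resolvent_pow_imaginary hρ hD0 hD S n hfd hf0 s
    -- For s in [t - 1, t] and t ≥ 3 one has s - 1 ≥ t - 2 ≥ t/3; the division by K comes from T(t)
    -- = T(t-s)T(s) with t - s ≤ 1.
    set L : ℝ := (t / 3) ^ n / n ! * c * (‖T.op t.toNNReal (S z)‖ / K)
    have hL : ∀ s ∈ Icc (t - 1) t, L ≤ ‖h s‖ := by
      intro s hs
      have hs1 : 1 ≤ s := by linarith [hs.1]
      rw [hh]
      refine le_trans ?_ (T.norm_integral_orbit_ge S hST n hwz hs1)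
      change _ ≤ (s - 1) ^ n / n ! * c * _
      have h3 : t / 3 ≤ s - 1 := by linarith [hs.1]
      have h4 : ‖T.op t.toNNReal (S z)‖ / K ≤ ‖T.op s.toNNReal (S z)‖ := by
        rw [div_le_iff₀' hK]
        have h5 : t.toNNReal = (t - s).toNNReal + s.toNNReal := by
          rw [← Real.toNNReal_add (by linarith [hs.2]) (by linarith)]
          ring_nf
        rw [h5, T.op_add_apply]
        exact hTK _ (by linarith [hs.2]) (by linarith [hs.1]) _
      simp only [L]
      gcongr
    have hLB : L ≤ B * (K * ‖z‖) := by
      have := ((eLpNorm_ge_of_unit_interval hq (by positivity) hL).trans h2).trans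
        (mul_le_mul_right (eLpNorm_le_of_unit_support p hf0 hfK) _)
      rw [← ENNReal.ofReal_coe_nnreal, ← ENNReal.ofReal_mul B.coe_nonneg,
        ENNReal.ofReal_le_ofReal_iff (by positivity)] at this
      exact this
    have hLe : t ^ n * ‖T.op t.toNNReal (S z)‖ = 3 ^ n * n ! / c * K * L := by
      simp only [L, div_pow]
      field_simp
    rw [hLe]
    calc _ ≤ 3 ^ n * n ! / c * K * (B * (K * ‖z‖)) := by gcongr
      _ = _ := by ring
  have hall : ∀ (x : X) (t : ℝ), 3 ≤ t → t ^ n * ‖T.op t.toNNReal (S x)‖ ≤ C₁ * ‖x‖ := by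
    intro x t ht
    -- The bound does not involve w, so it extends from vectors with smooth orbit to all of X by
    -- density.
    choose z hz w hw hwz using fun i : ℕ =>
      T.exists_smooth_orbit x (ε := 1 / ((i : ℝ) + 1)) (by positivity)
    have hzx : Tendsto z atTop (𝓝 x) := by
      rw [tendsto_iff_norm_sub_tendsto_zero]
      exact squeeze_zero (fun _ => norm_nonneg _) (fun i => (hz i).le)
        tendsto_one_div_add_atTop_nhds_zero_nat
    refine le_of_tendsto_of_tendsto' ?_ (hzx.norm.const_mul C₁)
      fun i => hsmooth (z i) (w i) (hw i) (hwz i) t ht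
    exact ((((T.op _).continuous.comp S.continuous).tendsto x).comp hzx).norm.const_mul _
  -- Covers the remaining range 1 ≤ t ≤ 3.
  set C₂ : ℝ := 3 ^ n * (M * Real.exp (ω * 3)) * ‖S‖
  refine ⟨C₁ + C₂, by positivity, fun x t ht => ?_⟩
  have ht1 : (1 : ℝ) ≤ t := by exact_mod_cast ht
  have hmain : (t : ℝ) ^ n * ‖T.op t (S x)‖ ≤ (C₁ + C₂) * ‖x‖ := by
    rw [add_mul]
    rcases le_total 3 (t : ℝ) with h3 | h3
    · have := hall x t h3
      rw [Real.toNNReal_coe] at this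
      exact this.trans (le_add_of_nonneg_right (by positivity))
    · have := hTle 3 t t.2 h3 (S x)
      rw [Real.toNNReal_coe] at this
      refine le_trans ?_ (le_add_of_nonneg_left (by positivity))
      calc _ ≤ 3 ^ n * (M * Real.exp (ω * 3) * (‖S‖ * ‖x‖)) := by
            gcongr
            exact this.trans (by gcongr; exact S.le_opNorm x)
        _ = _ := by ring
  rw [zpow_neg, zpow_natCast, mul_right_comm, ← div_eq_mul_inv, le_div_iff₀ (by positivity),
    mul_comm]
  exact hmain

end Necessity

/-! ### Products of Balakrishnan integrals in a Banach algebra. -/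

section Balakrishnan

variable {B : Type*} [NormedRing B] [NormedAlgebra ℂ B]

theorem integrableOn_rpow_neg_mul_inv_one_add {θ : ℝ} (hθ : 0 < θ) (hθ1 : θ < 1) :
    IntegrableOn (fun s : ℝ => s ^ (-θ) * (1 + s)⁻¹) (Ioi 0) := by
  rw [← Ioc_union_Ioi_eq_Ioi zero_le_one]
  have hm : Measurable fun s : ℝ => s ^ (-θ) * (1 + s)⁻¹ := by fun_prop
  refine IntegrableOn.union ?_ ?_
  · have h : IntegrableOn (fun s : ℝ => s ^ (-θ)) (Ioc 0 1) := by
      rw [← intervalIntegrable_iff_integrableOn_Ioc_of_le zero_le_one]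
      exact intervalIntegral.intervalIntegrable_rpow' (by linarith)
    refine Integrable.mono' h hm.aestronglyMeasurable ?_
    filter_upwards [ae_restrict_mem measurableSet_Ioc] with s hs
    have hs0 : 0 < s := hs.1
    rw [Real.norm_of_nonneg (by positivity)]
    exact mul_le_of_le_one_right (by positivity) (inv_le_one_of_one_le₀ (by linarith))
  · have h : IntegrableOn (fun s : ℝ => s ^ (-θ - 1)) (Ioi 1) :=
      integrableOn_Ioi_rpow_of_lt (by linarith) one_pos
    refine Integrable.mono' h hm.aestronglyMeasurable ?_
    filter_upwards [ae_restrict_mem measurableSet_Ioi] with s hs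
    have hs0 : (0 : ℝ) < s := one_pos.trans hs
    rw [Real.norm_of_nonneg (by positivity), Real.rpow_sub hs0, Real.rpow_one, div_eq_mul_inv]
    gcongr
    linarith

theorem integrableOn_rpow_smul {r : ℝ → B} (hr : Continuous r) {K : ℝ}
    (hK : ∀ s, 0 ≤ s → ‖r s‖ ≤ K * (1 + s)⁻¹) {θ : ℝ} (hθ : 0 < θ) (hθ1 : θ < 1) :
    IntegrableOn (fun s : ℝ => s ^ (-θ) • r s) (Ioi 0) := by
  refine Integrable.mono' ((integrableOn_rpow_neg_mul_inv_one_add hθ hθ1).const_mul K) ?_ ?_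
  · have hm : Measurable fun s : ℝ => s ^ (-θ) := by fun_prop
    exact hm.aestronglyMeasurable.smul hr.aestronglyMeasurable
  · filter_upwards [ae_restrict_mem measurableSet_Ioi] with s hs
    have hs0 : (0 : ℝ) < s := hs
    rw [norm_smul, Real.norm_of_nonneg (by positivity), mul_left_comm]
    gcongr
    exact hK s hs0.le

theorem rpow_neg_eq_mul {t u : ℝ} (ht : 0 < t) (hu : 0 < u) (θ : ℝ) :
    u ^ (-θ) = t ^ θ * (t * u) ^ (-θ) := by
  rw [Real.mul_rpow ht.le hu.le, ← mul_assoc, ← Real.rpow_add ht]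
  simp

/-- Substituting s = tu in the integral over u leaves t^{θ-1}‖r t‖ times a constant, which is again
a Balakrishnan integrand, with exponent 1 - θ in (0, 1). -/
theorem integrable_balakrishnan_prod {r : ℝ → B} (hr : Continuous r) {K : ℝ}
    (hK : ∀ s, 0 ≤ s → ‖r s‖ ≤ K * (1 + s)⁻¹) {θ : ℝ} (hθ : 0 < θ) (hθ1 : θ < 1) :
    Integrable (Function.uncurry fun t u : ℝ => u ^ (-θ) • (r t * r (t * u)))
      ((volume.restrict (Ioi 0)).prod (volume.restrict (Ioi 0))) := by
  have hm : Measurable fun z : ℝ × ℝ => z.2 ^ (-θ) := by fun_prop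
  have hpos : ∀ᵐ z : ℝ × ℝ ∂((volume.restrict (Ioi 0)).prod (volume.restrict (Ioi (0 : ℝ)))),
      z.2 ∈ Ioi (0 : ℝ) :=
    Measure.quasiMeasurePreserving_snd.ae (ae_restrict_mem measurableSet_Ioi)
  have hH : Integrable (Function.uncurry fun t u : ℝ => u ^ (-θ) * (‖r t‖ * ‖r (t * u)‖))
      ((volume.restrict (Ioi 0)).prod (volume.restrict (Ioi 0))) := by
    have h1 := (integrableOn_rpow_smul hr hK hθ hθ1).norm
    have e : ∀ t : ℝ, 0 < t → ∀ u ∈ Ioi (0 : ℝ), u ^ (-θ) * (‖r t‖ * ‖r (t * u)‖) =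
        (t ^ θ * ‖r t‖) * ‖(t * u) ^ (-θ) • r (t * u)‖ := by
      intro t ht u hu
      have hu0 : (0 : ℝ) < u := hu
      rw [norm_smul, Real.norm_of_nonneg (by positivity), rpow_neg_eq_mul ht hu0]
      ring
    refine (integrable_prod_iff ?_).2 ⟨?_, ?_⟩
    · refine hm.aestronglyMeasurable.mul (Continuous.aestronglyMeasurable ?_)
      exact (hr.comp continuous_fst).norm.mul
        (hr.comp (continuous_fst.mul continuous_snd)).norm
    · filter_upwards [ae_restrict_mem measurableSet_Ioi] with t ht
      have ht0 : (0 : ℝ) < t := ht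
      have h2 := (integrableOn_Ioi_comp_mul_left_iff (fun s : ℝ => ‖s ^ (-θ) • r s‖) 0 ht0).2
        (by rw [mul_zero]; exact h1)
      have h3 := h2.const_mul (t ^ θ * ‖r t‖)
      exact IntegrableOn.congr_fun h3 (fun u hu => (e t ht0 u hu).symm) measurableSet_Ioi
    · have h2 := ((integrableOn_rpow_smul hr hK (sub_pos.2 hθ1) (by linarith : 1 - θ < 1)).norm).mul_const
        (∫ s in Ioi (0 : ℝ), ‖s ^ (-θ) • r s‖)
      refine IntegrableOn.congr_fun h2 (fun t ht => ?_) measurableSet_Ioi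
      have ht0 : (0 : ℝ) < t := ht
      have h3 : ∫ u in Ioi (0 : ℝ), ‖u ^ (-θ) * (‖r t‖ * ‖r (t * u)‖)‖ =
          ∫ u in Ioi (0 : ℝ), (t ^ θ * ‖r t‖) * ‖(t * u) ^ (-θ) • r (t * u)‖ := by
        refine setIntegral_congr_fun measurableSet_Ioi fun u hu => ?_
        have hu0 : (0 : ℝ) < u := hu
        rw [Real.norm_of_nonneg (by positivity), e t ht0 u hu]
      simp only [Function.uncurry_apply_pair]
      rw [h3, integral_const_mul,
        integral_comp_mul_left_Ioi (fun s : ℝ => ‖s ^ (-θ) • r s‖) 0 ht0, mul_zero, norm_smul,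
        Real.norm_of_nonneg (by positivity), neg_sub, Real.rpow_sub ht0, Real.rpow_one, smul_eq_mul]
      field_simp
  refine hH.mono' ?_ ?_
  · refine hm.aestronglyMeasurable.smul (Continuous.aestronglyMeasurable ?_)
    exact (hr.comp continuous_fst).mul (hr.comp (continuous_fst.mul continuous_snd))
  · filter_upwards [hpos] with z hz
    have hz0 : (0 : ℝ) < z.2 := hz
    simp only [Function.uncurry_def]
    rw [norm_smul, Real.norm_of_nonneg (by positivity)]
    gcongr
    exact norm_mul_le _ _

variable [CompleteSpace B]

/-- The product of the Balakrishnan integrals with exponents `θ` and `1 - θ` is a positive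
multiple of the resolvent at `0`. -/
theorem exists_balakrishnan_mul {r : ℝ → B} (hr : Continuous r) {K : ℝ}
    (hK : ∀ s, 0 ≤ s → ‖r s‖ ≤ K * (1 + s)⁻¹)
    (hres : ∀ s t, 0 ≤ s → 0 ≤ t → r s - r t = (t - s) • (r s * r t)) (h0 : r 0 ≠ 0)
    {θ : ℝ} (hθ : 0 < θ) (hθ1 : θ < 1) :
    ∃ c : ℝ, 0 < c ∧ (∫ t in Ioi (0 : ℝ), t ^ (-(1 - θ)) • r t) *
      (∫ s in Ioi (0 : ℝ), s ^ (-θ) • r s) = c • r 0 := by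
  have hprod := integrable_balakrishnan_prod hr hK hθ hθ1
  -- After s = tu and an exchange of integrals, the resolvent identity turns (u - 1) r(t) r(tu) into
  -- (r(t) - r(ut))/t, whose integral over t is log u · r(0) by Frullani.
  set ψ : ℝ → ℝ := fun u => u ^ (-θ) * ((u - 1)⁻¹ * Real.log u) with hψ
  have hne : ∀ᵐ u ∂(volume.restrict (Ioi (0 : ℝ))), u ≠ 1 :=
    ae_restrict_of_ae (Measure.ae_ne volume 1)
  have hinner : ∀ᵐ u ∂(volume.restrict (Ioi (0 : ℝ))),
      ∫ t in Ioi (0 : ℝ), u ^ (-θ) • (r t * r (t * u)) = ψ u • r 0 := by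
    filter_upwards [ae_restrict_mem measurableSet_Ioi, hne, hprod.prod_left_ae] with u hu hu1 hi
    have hu0 : (0 : ℝ) < u := hu
    simp only [Function.uncurry_apply_pair] at hi
    have hpow : u ^ (-θ) ≠ 0 := (Real.rpow_pos_of_pos hu0 _).ne'
    have hi' : IntegrableOn (fun t => r t * r (t * u)) (Ioi 0) :=
      (integrable_smul_iff hpow _).1 hi
    have e : ∀ t ∈ Ioi (0 : ℝ), (u - 1) • (r t * r (t * u)) = t⁻¹ • (r (1 * t) - r (u * t)) := by
      intro t ht
      have ht0 : (0 : ℝ) < t := ht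
      rw [one_mul, mul_comm u t, hres t (t * u) ht0.le (by positivity), smul_smul]
      congr 1
      field_simp
    have hlim : Tendsto r atTop (𝓝 0) := by
      refine squeeze_zero_norm' ((eventually_ge_atTop 0).mono hK) ?_
      have : Tendsto (fun s : ℝ => (1 + s)⁻¹) atTop (𝓝 0) :=
        tendsto_inv_atTop_zero.comp (tendsto_atTop_add_const_left _ _ tendsto_id)
      simpa using this.const_mul K
    have hF := Frullani.integral_Ioi_eq (f := r) (L := r 0) (R := 0) (a := 1) (b := u)
      (hr.locallyIntegrable.locallyIntegrableOn _) one_pos hu0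
      ((hr.tendsto 0).mono_left nhdsWithin_le_nhds) hlim
      (IntegrableOn.congr_fun (hi'.smul (u - 1)) e measurableSet_Ioi)
    rw [← setIntegral_congr_fun measurableSet_Ioi e, integral_smul, div_one, sub_zero] at hF
    rw [integral_smul, hψ]
    simp only [mul_smul]
    rw [← hF, inv_smul_smul₀ (sub_ne_zero.2 hu1)]
  -- Fubini gives integrability of ψ · r(0) only; r(0) ≠ 0 transfers it to ψ.
  have hψi : IntegrableOn ψ (Ioi 0) := by
    have := hprod.integral_prod_right
    exact (integrable_smul_const h0).1 (this.congr hinner)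
  have hψpos : ∀ u : ℝ, 0 < u → u ≠ 1 → 0 < ψ u := by
    intro u hu hu1
    refine mul_pos (Real.rpow_pos_of_pos hu _) ?_
    rcases lt_or_gt_of_ne hu1 with h | h
    · exact mul_pos_of_neg_of_neg (inv_lt_zero.2 (by linarith)) (Real.log_neg hu h)
    · exact mul_pos (inv_pos.2 (by linarith)) (Real.log_pos h)
  refine ⟨∫ u in Ioi (0 : ℝ), ψ u, ?_, ?_⟩
  · rw [integral_pos_iff_support_of_nonneg_ae ?_ hψi]
    · refine lt_of_lt_of_le ?_ (measure_mono (s := Ioo (0 : ℝ) 1) fun u hu =>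
        (hψpos u hu.1 hu.2.ne).ne')
      rw [Measure.restrict_apply measurableSet_Ioo,
        inter_eq_left.2 (Ioo_subset_Ioi_self)]
      simp
    · filter_upwards [ae_restrict_mem measurableSet_Ioi, hne] with u hu hu1
      exact (hψpos u hu hu1).le
  · rw [← integral_smul_const, ← integral_congr_ae hinner, ← integral_integral_swap hprod,
      ← integral_mul_const_of_integrable
        (integrableOn_rpow_smul hr hK (sub_pos.2 hθ1) (by linarith : 1 - θ < 1))]
    refine setIntegral_congr_fun measurableSet_Ioi fun t ht => ?_
    have ht0 : (0 : ℝ) < t := ht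
    have hi := integrableOn_rpow_smul hr hK hθ hθ1
    have e : ∀ u ∈ Ioi (0 : ℝ), u ^ (-θ) • (r t * r (t * u)) =
        (t ^ θ • r t) * ((t * u) ^ (-θ) • r (t * u)) := by
      intro u hu
      rw [smul_mul_smul_comm, ← rpow_neg_eq_mul ht0 hu]
    have hi' := (integrableOn_Ioi_comp_mul_left_iff (fun s : ℝ => s ^ (-θ) • r s) 0 ht0).2
        (by rw [mul_zero]; exact hi)
    rw [setIntegral_congr_fun measurableSet_Ioi e, integral_const_mul_of_integrable hi',
      integral_comp_mul_left_Ioi (fun s : ℝ => s ^ (-θ) • r s) 0 ht0, mul_zero, mul_smul_comm,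
      smul_mul_assoc, smul_mul_assoc, smul_smul]
    congr 1
    rw [neg_sub, Real.rpow_sub ht0, Real.rpow_one]
    field_simp

end Balakrishnan

/-! ### Injectivity of (-A)^{-α} and its commutation with the semigroup. -/

section FractionalPowers

variable {X : Type*} [NormedAddCommGroup X] [NormedSpace ℂ X]

/-- The resolvent along the half line `[0, ∞)`, extended to a continuous function on `ℝ`. -/
noncomputable def realResolvent (A : X →ₗ.[ℂ] X) (s : ℝ) : X →L[ℂ] X :=
  resolvent A ((max s 0 : ℝ) : ℂ)

theorem realResolvent_of_nonneg (A : X →ₗ.[ℂ] X) {s : ℝ} (hs : 0 ≤ s) :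
    realResolvent A s = resolvent A (s : ℂ) := by
  rw [realResolvent, max_eq_left hs]

theorem resolvent_injective {A : X →ₗ.[ℂ] X} {μ : ℂ} (hμ : μ ∈ resolventSet A) :
    Function.Injective (resolvent A μ) := by
  refine (injective_iff_map_eq_zero _).2 fun x hx => ?_
  have h := mem_graph_resolvent hμ x
  rw [hx, smul_zero, zero_sub] at h
  exact neg_eq_zero.1 (A.graph_fst_eq_zero_snd h rfl)

theorem continuous_realResolvent {A : X →ₗ.[ℂ] X}
    (hc : ContinuousOn (resolvent A) {μ | 0 ≤ μ.re}) : Continuous (realResolvent A) :=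
  hc.comp_continuous (by fun_prop) (by simp)

/-- The fractional integral in Balakrishnan's formula, in terms of `realResolvent`. -/
theorem integral_rpow_smul_resolvent (A : X →ₗ.[ℂ] X) (θ : ℝ) :
    ∫ s in Ioi (0 : ℝ), s ^ (-θ) • resolvent A (s : ℂ) =
      ∫ s in Ioi (0 : ℝ), s ^ (-θ) • realResolvent A s :=
  setIntegral_congr_fun measurableSet_Ioi fun s hs => by
    simp only [realResolvent_of_nonneg A (le_of_lt (mem_Ioi.1 hs))]

variable [CompleteSpace X]

/-- The assumed growth bound controls only a bounded range of s; the decay at infinity comes from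
Hille–Yosida. -/
theorem C0Semigroup.exists_realResolvent_bound (T : C0Semigroup X)
    (hρ : ∀ μ : ℂ, 0 ≤ μ.re → μ ∈ resolventSet T.generator) {D : ℝ} {N : ℕ} (hD0 : 0 ≤ D)
    (hD : ∀ μ : ℂ, 0 ≤ μ.re → ‖resolvent T.generator μ‖ ≤ D * (1 + ‖μ‖) ^ N) :
    ∃ K, ∀ s, 0 ≤ s → ‖realResolvent T.generator s‖ ≤ K * (1 + s)⁻¹ := by
  obtain ⟨M, ω, hM, hω, hT⟩ := T.exists_exp_bound
  -- The ranges meet at s = 2ω + 1: below it 1 + s ≤ c, above it 1 + s ≤ 2(s - ω).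
  obtain ⟨c, hc⟩ : ∃ c, c = 2 + 2 * ω := ⟨_, rfl⟩
  refine ⟨max (D * c ^ N * c) (2 * M), fun s hs => ?_⟩
  rw [realResolvent_of_nonneg _ hs]
  have hs1 : 0 < 1 + s := by linarith
  rw [← div_eq_mul_inv, le_div_iff₀ hs1]
  rcases le_total s (2 * ω + 1) with h | h
  · refine le_trans ?_ (le_max_left _ _)
    have hsc : 1 + s ≤ c := by linarith
    have hc0 : 0 ≤ c := by linarith
    have h1 := hD s (by simpa using hs)
    rw [Complex.norm_real, Real.norm_of_nonneg hs] at h1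
    calc _ ≤ D * (1 + s) ^ N * (1 + s) := by gcongr
      _ ≤ _ := by gcongr
  · refine le_trans ?_ (le_max_right _ _)
    have h1 : 0 < s - ω := by linarith
    have := T.norm_resolvent_le hT (hρ s (by simpa using hs)) (by simp; linarith)
    rw [Complex.ofReal_re] at this
    calc _ ≤ M / (s - ω) * (1 + s) := by gcongr
      _ ≤ M / (s - ω) * (2 * (s - ω)) := by gcongr; linarith
      _ = 2 * M := by field_simp

/-- The Balakrishnan integral is injective. -/
theorem C0Semigroup.injective_balakrishnan (T : C0Semigroup X)
    (hρ : ∀ μ : ℂ, 0 ≤ μ.re → μ ∈ resolventSet T.generator) {D : ℝ} {N : ℕ} (hD0 : 0 ≤ D)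
    (hD : ∀ μ : ℂ, 0 ≤ μ.re → ‖resolvent T.generator μ‖ ≤ D * (1 + ‖μ‖) ^ N) {θ : ℝ}
    (hθ : 0 < θ) (hθ1 : θ < 1) :
    Function.Injective
      (∫ s in Ioi (0 : ℝ), s ^ (-θ) • resolvent T.generator (s : ℂ) : X →L[ℂ] X) := by
  have hinj := resolvent_injective (hρ 0 le_rfl)
  rcases subsingleton_or_nontrivial X with hX | hX
  · exact Function.injective_of_subsingleton _
  have hρs : ∀ s : ℝ, 0 ≤ s → (s : ℂ) ∈ resolventSet T.generator := fun s hs =>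
    hρ _ (by simpa using hs)
  obtain ⟨K, hK⟩ := T.exists_realResolvent_bound hρ hD0 hD
  have h00 : realResolvent T.generator 0 = resolvent T.generator 0 := by
    rw [realResolvent_of_nonneg _ le_rfl, Complex.ofReal_zero]
  have h0 : realResolvent T.generator 0 ≠ 0 := by
    intro h
    obtain ⟨x, hx⟩ := exists_ne (0 : X)
    refine hx (hinj ?_)
    rw [← h00, h]
    simp
  obtain ⟨c, hc, h⟩ := exists_balakrishnan_mul
    (continuous_realResolvent (continuousOn_resolvent_of_growth hρ hD)) hK
    (fun s t hs ht => by
      rw [realResolvent_of_nonneg _ hs, realResolvent_of_nonneg _ ht,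
        resolvent_sub_resolvent (hρs s hs) (hρs t ht), ← Complex.ofReal_sub, Complex.coe_smul])
    h0 hθ hθ1
  rw [integral_rpow_smul_resolvent]
  -- A vector killed by the θ-integral is killed by its product with the (1 - θ)-integral, a nonzero
  -- multiple of the injective R(0, A).
  refine (injective_iff_map_eq_zero _).2 fun x hx => hinj ?_
  have h1 := congrArg (fun L : X →L[ℂ] X => L x) h
  change (∫ t in Ioi (0 : ℝ), t ^ (-(1 - θ)) • realResolvent T.generator t)
    ((∫ s in Ioi (0 : ℝ), s ^ (-θ) • realResolvent T.generator s) x) =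
    c • realResolvent T.generator 0 x at h1
  rw [hx, map_zero, eq_comm, smul_eq_zero, or_iff_right hc.ne', h00] at h1
  rw [h1, map_zero]

theorem C0Semigroup.invFracPow_injective (T : C0Semigroup X)
    (hρ : ∀ μ : ℂ, 0 ≤ μ.re → μ ∈ resolventSet T.generator) {D : ℝ} {N : ℕ} (hD0 : 0 ≤ D)
    (hD : ∀ μ : ℂ, 0 ≤ μ.re → ‖resolvent T.generator μ‖ ≤ D * (1 + ‖μ‖) ^ N) (α : ℝ) :
    Function.Injective (invFracPow T.generator α) := by
  have h1 : Function.Injective (resolvent T.generator 0 ^ ⌊α⌋₊ : X →L[ℂ] X) := by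
    rw [FunLike.coe_pow_eq_iterate]
    exact (resolvent_injective (hρ 0 le_rfl)).iterate _
  rw [invFracPow, FunLike.coe_mul_eq_comp]
  refine h1.comp ?_
  split_ifs with h
  · exact fun _ _ h => h
  · have h0 : 0 < Int.fract α := lt_of_le_of_ne (Int.fract_nonneg α) (Ne.symm h)
    have h1 := Int.fract_lt_one α
    have hsin : Real.sin (Real.pi * Int.fract α) / Real.pi ≠ 0 := by
      refine div_ne_zero (Real.sin_pos_of_pos_of_lt_pi (by positivity) ?_).ne' Real.pi_ne_zero
      exact mul_lt_of_lt_one_right Real.pi_pos h1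
    intro x y hxy
    exact T.injective_balakrishnan hρ hD0 hD h0 h1 (smul_right_injective X hsin hxy)

theorem C0Semigroup.invFracPow_op (T : C0Semigroup X)
    (hρ : ∀ μ : ℂ, 0 ≤ μ.re → μ ∈ resolventSet T.generator) {D : ℝ} {N : ℕ} (hD0 : 0 ≤ D)
    (hD : ∀ μ : ℂ, 0 ≤ μ.re → ‖resolvent T.generator μ‖ ≤ D * (1 + ‖μ‖) ^ N) (α : ℝ)
    (t : ℝ≥0) (x : X) :
    invFracPow T.generator α (T.op t x) = T.op t (invFracPow T.generator α x) := by
  have hR : ∀ s : ℝ, 0 ≤ s → Commute (T.op t) (resolvent T.generator (s : ℂ)) := by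
    intro s hs
    ext y
    exact T.op_resolvent (hρ _ (by simpa using hs)) t y
  suffices h : Commute (T.op t) (invFracPow T.generator α) from
    (congrArg (fun L : X →L[ℂ] X => L x) h.eq).symm
  refine Commute.mul_right (Commute.pow_right (by simpa using hR 0 le_rfl) _) ?_
  split_ifs with h
  · exact Commute.one_right _
  · have h0 : 0 < Int.fract α := lt_of_le_of_ne (Int.fract_nonneg α) (Ne.symm h)
    obtain ⟨K, hK⟩ := T.exists_realResolvent_bound hρ hD0 hD
    have hi := integrableOn_rpow_smul
      (continuous_realResolvent (continuousOn_resolvent_of_growth hρ hD)) hK h0 (Int.fract_lt_one α)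
    refine Commute.smul_right ?_ _
    rw [integral_rpow_smul_resolvent, Commute, SemiconjBy,
      ← integral_const_mul_of_integrable hi, ← integral_mul_const_of_integrable hi]
    refine setIntegral_congr_fun measurableSet_Ioi fun s hs => ?_
    have := (hR s (le_of_lt (mem_Ioi.1 hs))).eq
    simp only [realResolvent_of_nonneg _ (le_of_lt (mem_Ioi.1 hs))]
    rw [mul_smul_comm, smul_mul_assoc, this]

end FractionalPowers

/-! ### The domain of the fractional power as a copy of X. -/

section Domain

variable {X : Type*} [NormedAddCommGroup X] [NormedSpace ℂ X]

/-- The domain of the inverse of an injective bounded operator `S`, with the graph norm, is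
isomorphic to the whole space through `S`. -/
theorem exists_dom_equiv (S : X →L[ℂ] X) (hS : Function.Injective S) :
    ∃ e : X ≃L[ℂ] Dom (LinearMap.toPMap (S : X →ₗ[ℂ] X) ⊤).inverse,
      ∀ x, Dom.incl _ (e x) = S x := by
  set P := LinearMap.toPMap (S : X →ₗ[ℂ] X) ⊤
  have hker : LinearMap.ker P.toFun = ⊥ := by
    rw [LinearMap.ker_eq_bot]
    intro x y hxy
    exact Subtype.ext (hS hxy)
  have hmem : ∀ x, S x ∈ P.inverse.domain := by
    intro x
    rw [LinearPMap.inverse_domain]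
    exact ⟨⟨x, trivial⟩, rfl⟩
  have happ : ∀ x, P.inverse ⟨S x, hmem x⟩ = x := fun x =>
    LinearPMap.inverse_apply_eq hker (y := ⟨S x, hmem x⟩) (x := ⟨x, trivial⟩) rfl
  let f : X →ₗ[ℂ] Dom P.inverse :=
    { toFun := fun x => (⟨S x, hmem x⟩ : P.inverse.domain)
      map_add' := fun x y => Subtype.ext (map_add S x y)
      map_smul' := fun c x => Subtype.ext (map_smul S c x) }
  have hfi : ∀ x, Dom.inclₗ _ (f x) = S x := fun x => rfl
  have hfa : ∀ x, Dom.applyₗ _ (f x) = x := happ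
  let F : X →L[ℂ] Dom P.inverse := f.mkContinuous (‖S‖ + 1) fun x => by
    rw [Dom.norm_def, hfi, hfa, add_mul, one_mul]
    gcongr
    exact S.le_opNorm x
  let G : Dom P.inverse →L[ℂ] X := (Dom.applyₗ P.inverse).mkContinuous 1 fun y => by
    rw [one_mul, Dom.norm_def]
    exact le_add_of_nonneg_left (norm_nonneg _)
  refine ⟨ContinuousLinearEquiv.equivOfInverse F G happ fun y => ?_, fun x => rfl⟩
  obtain ⟨y, hy⟩ := y
  have hy' := hy
  rw [LinearPMap.inverse_domain] at hy'
  obtain ⟨⟨x, -⟩, rfl⟩ := hy'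
  refine Subtype.ext ?_
  change S (P.inverse ⟨S x, hmem x⟩) = S x
  rw [happ]

end Domain

end PolyDecay

/-! ### The equivalence, by transport along S. -/

theorem theorem5p2 {X : Type*} [NormedAddCommGroup X] [NormedSpace ℂ X] [CompleteSpace X]
    (T : PolyDecay.C0Semigroup X) (α : ℝ) (hα : 0 ≤ α) (n : ℕ)
    (hρ : ∀ μ : ℂ, 0 ≤ μ.re → μ ∈ PolyDecay.resolventSet T.generator)
    (hgrowth : ∃ β C' : ℝ, 0 ≤ β ∧ 0 ≤ C' ∧ ∀ μ : ℂ, 0 ≤ μ.re →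
      ‖PolyDecay.resolvent T.generator μ‖ ≤ C' * (1 + ‖μ‖) ^ β) :
    (∀ k ∈ Finset.Icc 1 (n + 1), ∃ p q : ℝ≥0∞, 1 ≤ p ∧ 1 ≤ q ∧
      PolyDecay.IsBoundedMultiplier p q fun ξ : ℝ =>
        ((PolyDecay.resolvent T.generator (Complex.I * ξ)) ^ k).comp
          (PolyDecay.Dom.incl (PolyDecay.fracPow T.generator α))) ↔
    ∃ C : ℝ, 0 ≤ C ∧ ∀ x : PolyDecay.Dom (PolyDecay.fracPow T.generator α), ∀ t : ℝ≥0, 1 ≤ t →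
      ‖T.op t (PolyDecay.Dom.incl (PolyDecay.fracPow T.generator α) x)‖
        ≤ C * (t : ℝ) ^ (-(n : ℤ)) * ‖x‖ := by
  obtain ⟨D, N, hD0, hD⟩ := PolyDecay.exists_nat_growth hgrowth
  set S := PolyDecay.invFracPow T.generator α
  obtain ⟨e, he⟩ : ∃ e : X ≃L[ℂ] PolyDecay.Dom (PolyDecay.fracPow T.generator α),
      ∀ x, PolyDecay.Dom.incl _ (e x) = S x :=
    PolyDecay.exists_dom_equiv S (T.invFracPow_injective hρ hD0 hD α)
  -- Completeness of the domain is transported from X; composing multipliers with e and its inverse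
  -- needs it.
  have : CompleteSpace (PolyDecay.Dom (PolyDecay.fracPow T.generator α)) :=
    (completeSpace_congr (e := e.toEquiv) e.isUniformEmbedding).1 inferInstance
  have hincl : PolyDecay.Dom.incl (PolyDecay.fracPow T.generator α) =
      S.comp (e.symm : PolyDecay.Dom (PolyDecay.fracPow T.generator α) →L[ℂ] X) := by
    ext y
    simp [← he]
  constructor
  · intro h
    -- Only the highest power enters.
    obtain ⟨p, q, -, hq, hm⟩ := h (n + 1) (by simp)
    have hm' := hm.comp (e : X →L[ℂ] PolyDecay.Dom (PolyDecay.fracPow T.generator α))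
    have hS : ∀ ξ : ℝ, (((PolyDecay.resolvent T.generator (Complex.I * ξ)) ^ (n + 1)).comp
        (PolyDecay.Dom.incl (PolyDecay.fracPow T.generator α))).comp
        (e : X →L[ℂ] PolyDecay.Dom (PolyDecay.fracPow T.generator α)) =
        ((PolyDecay.resolvent T.generator (Complex.I * ξ)) ^ (n + 1)).comp S := by
      intro ξ
      ext x
      simp [he]
    simp only [hS] at hm'
    obtain ⟨C, hC, hdec⟩ := T.decay_of_isBoundedMultiplier hρ hD0 hD S
      (T.invFracPow_op hρ hD0 hD α) n hq hm'
    refine ⟨C * ‖(e.symm : PolyDecay.Dom (PolyDecay.fracPow T.generator α) →L[ℂ] X)‖,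
      by positivity, fun x t ht => ?_⟩
    rw [hincl]
    refine (hdec (e.symm x) t ht).trans ?_
    calc _ ≤ C * (t : ℝ) ^ (-(n : ℤ)) *
          (‖(e.symm : PolyDecay.Dom (PolyDecay.fracPow T.generator α) →L[ℂ] X)‖ * ‖x‖) := by
          gcongr
          exact ContinuousLinearMap.le_opNorm
            (e.symm : PolyDecay.Dom (PolyDecay.fracPow T.generator α) →L[ℂ] X) x
      _ = _ := by ring
  · rintro ⟨C, hC, hdec⟩ k hk
    obtain ⟨hk1, hkn⟩ := Finset.mem_Icc.1 hk
    obtain ⟨k, rfl⟩ : ∃ j, k = j + 1 := ⟨k - 1, by omega⟩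
    -- p = 1 and q = ∞ serve for every k, since each kernel is bounded.
    refine ⟨1, ⊤, le_rfl, le_top, ?_⟩
    have hdec' : ∀ (x : X) (t : ℝ≥0), 1 ≤ t → ‖T.op t (S x)‖ ≤
        (C * ‖(e : X →L[ℂ] PolyDecay.Dom (PolyDecay.fracPow T.generator α))‖) *
          (t : ℝ) ^ (-(n : ℤ)) * ‖x‖ := by
      intro x t ht
      rw [← he]
      refine (hdec (e x) t ht).trans ?_
      calc _ ≤ C * (t : ℝ) ^ (-(n : ℤ)) *
            (‖(e : X →L[ℂ] PolyDecay.Dom (PolyDecay.fracPow T.generator α))‖ * ‖x‖) := by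
            gcongr
            exact ContinuousLinearMap.le_opNorm
              (e : X →L[ℂ] PolyDecay.Dom (PolyDecay.fracPow T.generator α)) x
        _ = _ := by ring
    have hm := T.isBoundedMultiplier_of_decay hρ hD0 hD S (by positivity) hdec'
      (show k ≤ n by omega)
    rw [hincl]
    exact hm.comp (e.symm : PolyDecay.Dom (PolyDecay.fracPow T.generator α) →L[ℂ] X)
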